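/- Let $n\ge 0$ and let $C$ be a closed (compact, without boundary) connected smooth manifold of dimension $2n+1$ with a contact form $\theta$, i.e. a nowhere vanishing smooth $1$-form such that $d\theta$ is nondegenerate on $\ker\theta$. On $C\times(0,\infty)$, with coordinate $t$ on the second factor and projection $\pi$ to $C$, consider the symplectic form $\Omega=dt\wedge\pi^*\theta+t\,\pi^*d\theta=d(t\,\pi^*\theta)$ of the symplectization. A *sym-con manifold* $(M,\omega,C,\theta)$ with convex (resp. concave) border is the interior $M$ of a compact smooth manifold with boundary $\bar M$ of dimension $2n+2$, with a symplectic form $\omega$ on $\bar M$, for which there are $0<a<b$, an open neighbourhood $V$ of $\partial\bar M$ in $\bar M$ and a diffeomorphism $\kappa:V\to C\times(a,b]$ (resp. $\kappa:V\to C\times[a,b)$) with $\kappa^*\Omega=\omega$ and $\kappa(\partial\bar M)=C\times\{b\}$ (resp. $C\times\{a\}$). Let $(M_1,\omega_1,C,\theta)$ be a sym-con manifold with convex border and $(M_2,\omega_2,C,\theta)$ a sym-con manifold with concave border, with identifications $\kappa_i=(p_i,t_i)$ defined on neighbourhoods $V_i$ of $\partial\bar M_i$ as above. Then there are a constant $\lambda>0$,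 a closed (compact, Hausdorff, without boundary) symplectic manifold $(X,\omega)$ of dimension $2n+2$ and smooth embeddings $\varphi_1:\bar M_1\to X$ and $\varphi_2:\bar M_2\to X$ such that $\varphi_1^*\omega=\omega_1$, $\varphi_2^*\omega=\lambda\omega_2$ and $\varphi_1(M_1)\cup\varphi_2(M_2)=X$. Moreover $X=M_1\cup_C M_2$ is obtained by gluing along the collars of $C$: for $x\in\bar M_1$ and $y\in\bar M_2$ one has $\varphi_1(x)=\varphi_2(y)$ if and only if $x\in V_1$, $y\in V_2$, $p_1(x)=p_2(y)$ and $t_1(x)=\lambda\,t_2(y)$. -/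

import Mathlib

universe u v w

open Set
open scoped Manifold ContDiff Topology

noncomputable section

namespace SymCon

section Forms

variable {E : Type*} [NormedAddCommGroup E] [NormedSpace ℝ E]
  {H : Type*} [TopologicalSpace H] (I : ModelWithCorners ℝ E H)
  {E' : Type*} [NormedAddCommGroup E'] [NormedSpace ℝ E']
  {H' : Type*} [TopologicalSpace H'] (I' : ModelWithCorners ℝ E' H')
  (M : Type*) [TopologicalSpace M] [ChartedSpace H M]
  {N : Type*} [TopologicalSpace N] [ChartedSpace H' N]

/-- (Not necessarily continuous) differential `k`-forms on a manifold `M`, possibly with boundary: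
an alternating `k`-linear form on every tangent space. -/
abbrev Form (k : ℕ) : Type _ := ∀ x : M, TangentSpace I x [⋀^Fin k]→L[ℝ] ℝ

variable {M}

/-- The pullback `f^* σ` of a form by a differentiable map. -/
def pullback {k : ℕ} (f : M → N) (σ : Form I' N k) : Form I M k := fun x ↦
  (σ (f x)).compContinuousLinearMap (mfderiv I I' f x)

/-- The expression of the form `σ` in the preferred chart at `x₀`: its pullback, by the inverse of
this chart, to the target of the chart, a relatively open subset of `range I`. -/
def chartForm {k : ℕ} (σ : Form I M k) (x₀ : M) : E → E [⋀^Fin k]→L[ℝ] ℝ := fun y ↦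
  (σ ((extChartAt I x₀).symm y)).compContinuousLinearMap
    (mfderivWithin 𝓘(ℝ, E) I (extChartAt I x₀).symm (range I) y)

/-- A form is smooth if it is smooth in the charts. -/
def IsSmooth {k : ℕ} (σ : Form I M k) : Prop :=
  ∀ x₀ : M, ContDiffOn ℝ ∞ (chartForm I σ x₀) (extChartAt I x₀).target

/-- The exterior derivative: computed at `x` in the chart at `x` and pulled back to `M`. -/
def extD {k : ℕ} (σ : Form I M k) : Form I M (k + 1) := fun x ↦
  (extDerivWithin (chartForm I σ x) (range I) (extChartAt I x x)).compContinuousLinearMap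
    (mfderiv I 𝓘(ℝ, E) (extChartAt I x) x)

/-- Symplectic forms: smooth, closed, nondegenerate `2`-forms. -/
structure IsSymplectic (σ : Form I M 2) : Prop where
  smooth : IsSmooth I σ
  closed : ∀ x, extD I σ x = 0
  nondegenerate : ∀ (x : M) (u : TangentSpace I x), (∀ v, σ x ![u, v] = 0) → u = 0

/-- Contact forms: smooth nowhere vanishing `1`-forms `θ` such that `dθ` is nondegenerate on
`ker θ`. -/
structure IsContactForm (θ : Form I M 1) : Prop where
  smooth : IsSmooth I θ
  ne_zero : ∀ x, θ x ≠ 0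
  nondegenerate : ∀ (x : M) (u : TangentSpace I x), θ x ![u] = 0 →
    (∀ v, θ x ![v] = 0 → extD I θ x ![u, v] = 0) → u = 0

/-- The wedge product `α ∧ β` of two linear forms,
`(α ∧ β)(u, v) = α u * β v - α v * β u`. -/
def wedge (α : E →L[ℝ] ℝ) (β : E [⋀^Fin 1]→L[ℝ] ℝ) : E [⋀^Fin 2]→L[ℝ] ℝ :=
  ContinuousAlternatingMap.alternatizeUncurryFin (α.smulRight β)

/-- The form `dt ∧ π^* θ + t π^* dθ = d(t π^* θ)` on `M × ℝ`, where `t` is the coordinate of `ℝ` and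
`π : M × ℝ → M` the projection. For a contact form `θ` its restriction to `M × (0, ∞)` is the
symplectic form of the symplectization. The tangent space of `M × ℝ` at `p` is `E × ℝ`, the
differentials of the two projections being those of the product. -/
def symplectizationForm (θ : Form I M 1) : Form (I.prod 𝓘(ℝ, ℝ)) (M × ℝ) 2 := fun p ↦
  let π : E × ℝ →L[ℝ] E := ContinuousLinearMap.fst ℝ E ℝ
  let dt : E × ℝ →L[ℝ] ℝ := ContinuousLinearMap.snd ℝ E ℝ
  let θ' : E [⋀^Fin 1]→L[ℝ] ℝ := θ p.1
  let dθ' : E [⋀^Fin 2]→L[ℝ] ℝ := extD I θ p.1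
  (wedge dt (θ'.compContinuousLinearMap π) + p.2 • dθ'.compContinuousLinearMap π :
    (E × ℝ) [⋀^Fin 2]→L[ℝ] ℝ)

end Forms

section Border

variable {E : Type*} [NormedAddCommGroup E] [NormedSpace ℝ E]
  {H : Type*} [TopologicalSpace H] (I : ModelWithCorners ℝ E H)
  {E' : Type*} [NormedAddCommGroup E'] [NormedSpace ℝ E']
  {H' : Type*} [TopologicalSpace H'] (I' : ModelWithCorners ℝ E' H')
  {M : Type*} [TopologicalSpace M] [ChartedSpace H M]
  {C : Type*} [TopologicalSpace C] [ChartedSpace H' C]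

/-- `κ` is a symplectomorphism from an open neighbourhood `κ.source` of the boundary of `(M, σ)`
onto the piece `C × T` of the symplectization of `(C, θ)`, taking the boundary of `M` to
`C × {e}`. -/
structure IsBorderModel (σ : Form I M 2) (θ : Form I' C 1) (κ : PartialEquiv M (C × ℝ))
    (T : Set ℝ) (e : ℝ) : Prop where
  isOpen_source : IsOpen κ.source
  boundary_subset : I.boundary M ⊆ κ.source
  target_eq : κ.target = univ ×ˢ T
  mem_boundary_iff : ∀ x ∈ κ.source, x ∈ I.boundary M ↔ (κ x).2 = e
  contMDiffOn : ContMDiffOn I (I'.prod 𝓘(ℝ, ℝ)) ∞ κ κ.source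
  contMDiffOn_symm : ContMDiffOn (I'.prod 𝓘(ℝ, ℝ)) I ∞ κ.symm κ.target
  symplectic : ∀ x ∈ κ.source,
    pullback I (I'.prod 𝓘(ℝ, ℝ)) κ (symplectizationForm I' θ) x = σ x

/-- `κ` identifies a neighbourhood of the boundary with the convex model `C × (a, b]`. -/
def IsConvexBorder (σ : Form I M 2) (θ : Form I' C 1) (κ : PartialEquiv M (C × ℝ)) : Prop :=
  ∃ a b : ℝ, 0 < a ∧ a < b ∧ IsBorderModel I I' σ θ κ (Ioc a b) b

/-- `κ` identifies a neighbourhood of the boundary with the concave model `C × [a, b)`. -/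
def IsConcaveBorder (σ : Form I M 2) (θ : Form I' C 1) (κ : PartialEquiv M (C × ℝ)) : Prop :=
  ∃ a b : ℝ, 0 < a ∧ a < b ∧ IsBorderModel I I' σ θ κ (Ico a b) a

end Border

end SymCon

end

/-! The symplectization form is homogeneous: `(p, t) ↦ (p, μ * t)` pulls `Ω` back to `μ • Ω`
(`pullback_scale_symplectizationForm`). So multiplying `ω₂` by `lam` amounts to moving its collar `C
× [a₂, b₂)` to `C × [lam * a₂, lam * b₂)`. Take `lam` with `a₁ < lam * a₂ < b₁ < lam * b₂`. Then the
two collars overlap exactly in `C × [lam * a₂, b₁]`, and the boundary of each piece falls in the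
interior of the other. Identify equal points of the overlap.

Everything follows from these two features of the overlap. It is compact, so the gluing relation is
closed and the quotient of two compact Hausdorff spaces is Hausdorff (`isClosed_collarRel`,
`Glue.t2Space`). And the interiors of the pieces already cover the quotient, so charts of the
interiors, pushed forward, form an atlas without boundary (`exists_chartedSpace_glue`). By
homogeneity `σ₁` and `lam • σ₂` agree on the overlap, and they define one form
(`exists_isSymplectic_glue`). In a pushed chart this form has the same coordinate expression as the
original one, so it is smooth and closed.

The inclusions are injective and continuous from compact to Hausdorff spaces, hence topological
embeddings. They are immersions at interior points by construction. Near a boundary point of one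
piece, the collar of the other extends the collar coordinate across the boundary, and the inclusion
becomes that of a half-space in the whole space (`isImmersionOfComplement_of_border`). -/

noncomputable section

namespace SymCon

/-! ### Topology of a quotient by a partial bijection -/

section Glue

variable {A : Type u} {B : Type v}

/-- A relation between `A` and `B` which is the graph of a partial bijection. -/
structure IsPartialBijection (r : A → B → Prop) : Prop where
  right_unique : ∀ {x y y'}, r x y → r x y' → y = y'
  left_unique : ∀ {x x' y}, r x y → r x' y → x = x'

/-- The equivalence relation on `A ⊕ B` generated by a partial bijection. -/
def glueSetoid {r : A → B → Prop} (hr : IsPartialBijection r) : Setoid (A ⊕ B) where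
  r s t := match s, t with
    | .inl x, .inl x' => x = x'
    | .inl x, .inr y => r x y
    | .inr y, .inl x => r x y
    | .inr y, .inr y' => y = y'
  iseqv := by
    refine ⟨?_, ?_, ?_⟩
    · rintro (x | y) <;> rfl
    · rintro (x | y) (x' | y') h
      · exact h.symm
      · exact h
      · exact h
      · exact h.symm
    · rintro (x | y) (x' | y') (x'' | y'') h h'
      · exact h.trans h'
      · exact h.symm ▸ h'
      · exact hr.left_unique h h'
      · exact h' ▸ h
      · exact h' ▸ h
      · exact hr.right_unique h h'
      · exact h.symm ▸ h'
      · exact h.trans h'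

/-- The space obtained by gluing `A` and `B` along a partial bijection. -/
def Glue {r : A → B → Prop} (hr : IsPartialBijection r) : Type (max u v) :=
  Quotient (glueSetoid hr)

namespace Glue

variable {r : A → B → Prop} (hr : IsPartialBijection r)

/-- The quotient map to a glued space. -/
def mk (s : A ⊕ B) : Glue hr := Quotient.mk (glueSetoid hr) s

/-- The first piece of a glued space. -/
def inl (x : A) : Glue hr := mk hr (.inl x)

/-- The second piece of a glued space. -/
def inr (y : B) : Glue hr := mk hr (.inr y)

lemma mk_surjective : Function.Surjective (mk hr) := Quotient.exists_rep

lemma inl_eq_inr {x : A} {y : B} : inl hr x = inr hr y ↔ r x y := Quotient.eq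

lemma inl_injective : Function.Injective (inl hr) := fun _ _ h ↦ Quotient.eq.1 h

lemma inr_injective : Function.Injective (inr hr) := fun _ _ h ↦ Quotient.eq.1 h

lemma exists_rep (z : Glue hr) : (∃ x, inl hr x = z) ∨ ∃ y, inr hr y = z := by
  obtain ⟨x | y, rfl⟩ := mk_surjective hr z
  exacts [.inl ⟨x, rfl⟩, .inr ⟨y, rfl⟩]

variable [TopologicalSpace A] [TopologicalSpace B]

instance : TopologicalSpace (Glue hr) :=
  inferInstanceAs (TopologicalSpace (Quotient (glueSetoid hr)))

instance [CompactSpace A] [CompactSpace B] : CompactSpace (Glue hr) :=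
  inferInstanceAs (CompactSpace (Quotient (glueSetoid hr)))

lemma continuous_inl : Continuous (inl hr) := continuous_quotient_mk'.comp _root_.continuous_inl

lemma continuous_inr : Continuous (inr hr) := continuous_quotient_mk'.comp _root_.continuous_inr

lemma isOpen_iff {U : Set (Glue hr)} :
    IsOpen U ↔ IsOpen (inl hr ⁻¹' U) ∧ IsOpen (inr hr ⁻¹' U) :=
  (isQuotientMap_quotient_mk' (s := glueSetoid hr)).isOpen_preimage.symm.trans isOpen_sum_iff

lemma isClosed_iff {U : Set (Glue hr)} :
    IsClosed U ↔ IsClosed (inl hr ⁻¹' U) ∧ IsClosed (inr hr ⁻¹' U) :=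
  (isQuotientMap_quotient_mk' (s := glueSetoid hr)).isClosed_preimage.symm.trans isClosed_sum_iff

variable [CompactSpace A] [CompactSpace B]

/-- The saturation of a closed set adds to each piece the points related to the part in the other
piece. That is the projection of a closed subset of `A × B` along a compact factor, hence closed. -/
lemma isClosedMap_mk (hc : IsClosed {p : A × B | r p.1 p.2}) :
    IsClosedMap (mk hr) := by
  intro S hS
  have hS' := isClosed_sum_iff.1 hS
  rw [isClosed_iff]
  constructor
  · have : inl hr ⁻¹' (mk hr '' S) = Sum.inl ⁻¹' S ∪
        Prod.fst '' ({p : A × B | r p.1 p.2} ∩ Prod.snd ⁻¹' (Sum.inr ⁻¹' S)) := by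
      ext x
      constructor
      · rintro ⟨x' | y, hs, h⟩
        · left
          rwa [mem_preimage, ← inl_injective hr h]
        · exact .inr ⟨(x, y), ⟨(inl_eq_inr hr).1 h.symm, hs⟩, rfl⟩
      · rintro (h | ⟨⟨x', y⟩, ⟨h, hs⟩, rfl⟩)
        · exact ⟨_, h, rfl⟩
        · exact ⟨.inr y, hs, ((inl_eq_inr hr).2 h).symm⟩
    rw [this]
    exact hS'.1.union (isClosedMap_fst_of_compactSpace _
      (hc.inter (hS'.2.preimage continuous_snd)))
  · have : inr hr ⁻¹' (mk hr '' S) = Sum.inr ⁻¹' S ∪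
        Prod.snd '' ({p : A × B | r p.1 p.2} ∩ Prod.fst ⁻¹' (Sum.inl ⁻¹' S)) := by
      ext y
      constructor
      · rintro ⟨x | y', hs, h⟩
        · exact .inr ⟨(x, y), ⟨(inl_eq_inr hr).1 h, hs⟩, rfl⟩
        · left
          rwa [mem_preimage, ← inr_injective hr h]
      · rintro (h | ⟨⟨x, y'⟩, ⟨h, hs⟩, rfl⟩)
        · exact ⟨_, h, rfl⟩
        · exact ⟨.inl x, hs, (inl_eq_inr hr).2 h⟩
    rw [this]
    exact hS'.2.union (isClosedMap_snd_of_compactSpace _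
      (hc.inter (hS'.1.preimage continuous_fst)))

/-- Gluing two compact Hausdorff spaces along a closed partial bijection gives a Hausdorff space. -/
lemma t2Space [T2Space A] [T2Space B] (hc : IsClosed {p : A × B | r p.1 p.2}) :
    T2Space (Glue hr) := by
  let q : A ⊕ B → Glue hr := mk hr
  have hq : Continuous q := continuous_quotient_mk'
  have hcl : IsClosedMap q := isClosedMap_mk hr hc
  have hT1 : T1Space (Glue hr) := ⟨fun z ↦ by
    obtain ⟨s, rfl⟩ : ∃ s, q s = z := mk_surjective hr z
    simpa using hcl _ (isClosed_singleton (x := s))⟩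
  -- A closed continuous map with compact fibres is proper, so its square `q × q` is again closed;
  -- the diagonal below is the image of a closed diagonal under it.
  have hp : IsProperMap q := by
    rw [isProperMap_iff_isClosedMap_and_compact_fibers]
    exact ⟨hq, hcl, fun z ↦ (isClosed_singleton.preimage hq).isCompact⟩
  rw [t2_iff_isClosed_diagonal]
  have : diagonal (Glue hr) = Prod.map q q '' diagonal (A ⊕ B) := by
    ext ⟨z, z'⟩
    constructor
    · intro h
      obtain rfl : z = z' := h
      obtain ⟨s, rfl⟩ : ∃ s, q s = z := mk_surjective hr z
      exact ⟨(s, s), rfl, rfl⟩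
    · rintro ⟨⟨s, s'⟩, h, h'⟩
      obtain rfl : s = s' := h
      exact (congrArg Prod.fst h').symm.trans (congrArg Prod.snd h')
  rw [this]
  exact (hp.prodMap hp).isClosedMap _ isClosed_diagonal

end Glue

end Glue

/-! ### Charts transported from the interior of a manifold with boundary -/

section PushChart

variable {E : Type*} [NormedAddCommGroup E] [NormedSpace ℝ E]
  {H : Type*} [TopologicalSpace H] (I : ModelWithCorners ℝ E H)
  {M : Type*} [TopologicalSpace M] [ChartedSpace H M]
  {N : Type*} [TopologicalSpace N] [ChartedSpace H N]
  {X : Type*} [TopologicalSpace X]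

/-- A model with corners, restricted to the preimage of the interior of its range. -/
def modelInterior : OpenPartialHomeomorph H E where
  toFun := I
  invFun := I.symm
  source := I ⁻¹' interior (range I)
  target := interior (range I)
  map_source' _ h := h
  map_target' y h := by rwa [mem_preimage, I.right_inv (interior_subset h)]
  left_inv' x _ := I.left_inv x
  right_inv' y h := I.right_inv (interior_subset h)
  open_source := isOpen_interior.preimage I.continuous
  open_target := isOpen_interior
  continuousOn_toFun := I.continuous.continuousOn
  continuousOn_invFun := I.continuous_symm.continuousOn

/-- The chart on `X` obtained from the preferred chart of `M` at `s` and the parametrization `Φ` of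
an open subset of `X` by an open subset of the interior of `M`. -/
def pushChart (Φ : OpenPartialHomeomorph M X) (s : M) : OpenPartialHomeomorph X E :=
  Φ.symm.trans ((chartAt H s).trans (modelInterior I))

variable {I}

lemma pushChart_apply (Φ : OpenPartialHomeomorph M X) (s : M) (z : X) :
    pushChart I Φ s z = extChartAt I s (Φ.symm z) := rfl

lemma pushChart_symm_apply (Φ : OpenPartialHomeomorph M X) (s : M) (y : E) :
    (pushChart I Φ s).symm y = Φ ((extChartAt I s).symm y) := rfl

lemma mem_pushChart_source {Φ : OpenPartialHomeomorph M X} {s : M} {z : X} :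
    z ∈ (pushChart I Φ s).source ↔ z ∈ Φ.target ∧ Φ.symm z ∈ (chartAt H s).source ∧
      extChartAt I s (Φ.symm z) ∈ interior (range I) := by
  simp [pushChart, modelInterior]

lemma mem_pushChart_target {Φ : OpenPartialHomeomorph M X} {s : M} {y : E} :
    y ∈ (pushChart I Φ s).target ↔ y ∈ interior (range I) ∧ y ∈ (extChartAt I s).target ∧
      (extChartAt I s).symm y ∈ Φ.source := by
  have : y ∈ (pushChart I Φ s).target ↔ (y ∈ interior (range I) ∧
      I.symm y ∈ (chartAt H s).target) ∧ (chartAt H s).symm (I.symm y) ∈ Φ.source := by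
    simp [pushChart, modelInterior]
  rw [this, extChartAt_target]
  have := interior_subset (s := range I)
  constructor
  · rintro ⟨⟨h1, h2⟩, h3⟩
    exact ⟨h1, ⟨h2, this h1⟩, h3⟩
  · rintro ⟨h1, ⟨h2, -⟩, h3⟩
    exact ⟨⟨h1, h2⟩, h3⟩

lemma mem_pushChart_source_self {Φ : OpenPartialHomeomorph M X} (hΦ : Φ.source ⊆ I.interior M)
    {s : M} (hs : s ∈ Φ.source) : Φ s ∈ (pushChart I Φ s).source := by
  rw [mem_pushChart_source, Φ.left_inv hs]
  exact ⟨Φ.map_source hs, mem_chart_source H s, hΦ hs⟩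

/-- The coordinate change factors as an inverse chart of `M`, the transition `Ψ⁻¹ ∘ Φ` between the
manifolds, and a chart of `N`; only the middle factor carries a hypothesis. -/
lemma contDiffOn_pushChart_coord_change [IsManifold I ∞ M] [IsManifold I ∞ N]
    {Φ : OpenPartialHomeomorph M X} {Ψ : OpenPartialHomeomorph N X}
    (h : ContMDiffOn I I ∞ (Φ.trans Ψ.symm) (Φ.trans Ψ.symm).source) (s : M) (t : N) :
    ContDiffOn ℝ ∞ ((pushChart I Φ s).symm.trans (pushChart I Ψ t))
      ((pushChart I Φ s).symm.trans (pushChart I Ψ t)).source := by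
  rw [← contMDiffOn_iff_contDiffOn]
  have h1 : ∀ y ∈ ((pushChart I Φ s).symm.trans (pushChart I Ψ t)).source,
      y ∈ (pushChart I Φ s).target ∧ Φ ((extChartAt I s).symm y) ∈ (pushChart I Ψ t).source := by
    intro y hy
    simpa [pushChart_symm_apply] using hy
  refine (contMDiffOn_extChartAt (I := I) (x := t) (n := ∞)).comp
    (h.comp ((contMDiffOn_extChartAt_symm (I := I) (n := ∞) s).mono ?_) ?_) ?_
  · exact fun y hy ↦ (mem_pushChart_target.1 (h1 y hy).1).2.1
  · intro y hy
    exact ⟨(mem_pushChart_target.1 (h1 y hy).1).2.2, (mem_pushChart_source.1 (h1 y hy).2).1⟩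
  · intro y hy
    exact (mem_pushChart_source.1 (h1 y hy).2).2.1

lemma contMDiffOn_trans_symm (Φ : OpenPartialHomeomorph M X) :
    ContMDiffOn I I ∞ (Φ.trans Φ.symm) (Φ.trans Φ.symm).source :=
  contMDiffOn_id.congr fun _ hx ↦ Φ.left_inv (by simpa using hx.1)

lemma contMDiffOn_of_pushChart_mem [ChartedSpace E X] {Φ : OpenPartialHomeomorph M X}
    (hΦ : Φ.source ⊆ I.interior M)
    (hX : ∀ s, pushChart I Φ s ∈ IsManifold.maximalAtlas 𝓘(ℝ, E) ∞ X) :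
    ContMDiffOn I 𝓘(ℝ, E) ∞ Φ Φ.source := by
  intro x hx
  refine ContMDiffAt.contMDiffWithinAt ?_
  have hsrc := mem_pushChart_source_self hΦ hx
  have h1 : ContMDiffAt 𝓘(ℝ, E) 𝓘(ℝ, E) ∞ (pushChart I Φ x).symm (extChartAt I x x) := by
    refine contMDiffAt_symm_of_mem_maximalAtlas (hX x) ?_
    have := (pushChart I Φ x).map_source hsrc
    rwa [pushChart_apply, Φ.left_inv hx] at this
  have h2 : ContMDiffAt I 𝓘(ℝ, E) ∞ (extChartAt I x) x := contMDiffAt_extChartAt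
  refine (h1.comp x h2).congr_of_eventuallyEq ?_
  filter_upwards [extChartAt_source_mem_nhds (I := I) x] with y hy
  simp only [Function.comp_apply, pushChart_symm_apply, (extChartAt I x).left_inv hy]

lemma contMDiffOn_symm_of_pushChart_mem [IsManifold I ∞ M] [ChartedSpace E X] {Φ : OpenPartialHomeomorph M X}
    (hΦ : Φ.source ⊆ I.interior M)
    (hX : ∀ s, pushChart I Φ s ∈ IsManifold.maximalAtlas 𝓘(ℝ, E) ∞ X) :
    ContMDiffOn 𝓘(ℝ, E) I ∞ Φ.symm Φ.target := by
  intro z hz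
  refine ContMDiffAt.contMDiffWithinAt ?_
  have hx := Φ.map_target hz
  have hsrc := mem_pushChart_source_self hΦ hx
  rw [Φ.right_inv hz] at hsrc
  have h1 : ContMDiffAt 𝓘(ℝ, E) 𝓘(ℝ, E) ∞ (pushChart I Φ (Φ.symm z)) z :=
    contMDiffAt_of_mem_maximalAtlas (hX _) hsrc
  have h2 : ContMDiffAt 𝓘(ℝ, E) I ∞ (extChartAt I (Φ.symm z)).symm
      (pushChart I Φ (Φ.symm z) z) :=
    (contMDiffWithinAt_extChartAt_symm_range (n := ∞) (Φ.symm z)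
      (mem_extChartAt_target (I := I) _)).contMDiffAt (range_mem_nhds_isInteriorPoint (hΦ hx))
  refine (h2.comp z h1).congr_of_eventuallyEq ?_
  filter_upwards [(pushChart I Φ (Φ.symm z)).open_source.mem_nhds hsrc] with y hy
  rw [Function.comp_apply, pushChart_apply, (extChartAt I _).left_inv]
  rw [extChartAt_source]
  exact (mem_pushChart_source.1 hy).2.1

open scoped Classical in
/-- The charted space structure on a space covered by open subsets of the interiors of two manifolds
with boundary. -/
@[reducible]
def gluedChartedSpace (Φ : OpenPartialHomeomorph M X) (Ψ : OpenPartialHomeomorph N X)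
    (hΦ : Φ.source ⊆ I.interior M) (hΨ : Ψ.source ⊆ I.interior N)
    (h : Φ.target ∪ Ψ.target = univ) : ChartedSpace E X where
  atlas := range (pushChart I Φ) ∪ range (pushChart I Ψ)
  chartAt z := if z ∈ Φ.target then pushChart I Φ (Φ.symm z) else pushChart I Ψ (Ψ.symm z)
  mem_chart_source z := by
    split_ifs with hz
    · simpa only [Φ.right_inv hz] using mem_pushChart_source_self hΦ (Φ.map_target hz)
    · replace hz : z ∈ Ψ.target := ((eq_univ_iff_forall.1 h) z).resolve_left hz
      simpa only [Ψ.right_inv hz] using mem_pushChart_source_self hΨ (Ψ.map_target hz)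
  chart_mem_atlas z := by
    split_ifs with hz
    exacts [.inl ⟨_, rfl⟩, .inr ⟨_, rfl⟩]

lemma isManifold_gluedChartedSpace [IsManifold I ∞ M] [IsManifold I ∞ N]
    (Φ : OpenPartialHomeomorph M X) (Ψ : OpenPartialHomeomorph N X)
    (hΦ : Φ.source ⊆ I.interior M) (hΨ : Ψ.source ⊆ I.interior N)
    (h : Φ.target ∪ Ψ.target = univ)
    (h₁ : ContMDiffOn I I ∞ (Φ.trans Ψ.symm) (Φ.trans Ψ.symm).source)
    (h₂ : ContMDiffOn I I ∞ (Ψ.trans Φ.symm) (Ψ.trans Φ.symm).source) :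
    letI := gluedChartedSpace Φ Ψ hΦ hΨ h
    IsManifold 𝓘(ℝ, E) ∞ X := by
  let _ := gluedChartedSpace Φ Ψ hΦ hΨ h
  refine isManifold_of_contDiffOn _ _ _ fun e e' he he' ↦ ?_
  have key : ContDiffOn ℝ ∞ (e.symm.trans e') (e.symm.trans e').source := by
    rcases he with ⟨s, rfl⟩ | ⟨s, rfl⟩ <;> rcases he' with ⟨t, rfl⟩ | ⟨t, rfl⟩
    · exact contDiffOn_pushChart_coord_change (contMDiffOn_trans_symm Φ) s t
    · exact contDiffOn_pushChart_coord_change h₁ s t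
    · exact contDiffOn_pushChart_coord_change h₂ s t
    · exact contDiffOn_pushChart_coord_change (contMDiffOn_trans_symm Ψ) s t
  simpa using key

end PushChart

/-! ### Pullback calculus for forms -/

section Pullback

variable {E : Type*} [NormedAddCommGroup E] [NormedSpace ℝ E]
  {H : Type*} [TopologicalSpace H] {I : ModelWithCorners ℝ E H}
  {E' : Type*} [NormedAddCommGroup E'] [NormedSpace ℝ E']
  {H' : Type*} [TopologicalSpace H'] {I' : ModelWithCorners ℝ E' H'}
  {E'' : Type*} [NormedAddCommGroup E''] [NormedSpace ℝ E'']
  {H'' : Type*} [TopologicalSpace H''] {I'' : ModelWithCorners ℝ E'' H''}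
  {M : Type*} [TopologicalSpace M] [ChartedSpace H M]
  {N : Type*} [TopologicalSpace N] [ChartedSpace H' N]
  {P : Type*} [TopologicalSpace P] [ChartedSpace H'' P] {k : ℕ}

/-- All tangent spaces are definitionally the model space, so forms at `y` and `y'` can be compared.
This allows the base point and the linear map to be replaced together, avoiding dependent rewriting.
-/
lemma form_comp_congr (σ : Form I' N k) {y y' : N} (h : y = y') {A A' : E →L[ℝ] E'}
    (hA : A = A') : (show E' [⋀^Fin k]→L[ℝ] ℝ from σ y).compContinuousLinearMap A =
      (show E' [⋀^Fin k]→L[ℝ] ℝ from σ y').compContinuousLinearMap A' := by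
  subst h hA
  rfl

lemma pullback_congr (σ : Form I' N k) {f g : M → N} {x : M} (h : f =ᶠ[𝓝 x] g) :
    pullback I I' f σ x = pullback I I' g σ x :=
  form_comp_congr (E := E) σ h.eq_of_nhds h.mfderiv_eq

lemma pullback_congr_form {σ τ : Form I' N k} {f : M → N} {x : M} (h : σ (f x) = τ (f x)) :
    pullback I I' f σ x = pullback I I' f τ x := by
  rw [pullback, pullback, h]

lemma pullback_comp (σ : Form I'' P k) {f : M → N} {g : N → P} {x : M}
    (hg : MDifferentiableAt I' I'' g (f x)) (hf : MDifferentiableAt I I' f x) :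
    pullback I I'' (g ∘ f) σ x = pullback I I' f (pullback I' I'' g σ) x := by
  rw [pullback, mfderiv_comp x hg hf]
  rfl

lemma pullback_eq_self (σ : Form I M k) {f : M → M} {x : M} (h : f =ᶠ[𝓝 x] id) :
    pullback I I f σ x = σ x := by
  rw [pullback_congr σ h, pullback, mfderiv_id]
  rfl

lemma pullback_smul (c : ℝ) (σ : Form I' N k) (f : M → N) :
    pullback I I' f (c • σ) = c • pullback I I' f σ := rfl

lemma chartForm_eq_pullback (σ : Form I M k) (x₀ : M) {y : E} (hy : range I ∈ 𝓝 y) :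
    chartForm I σ x₀ y = pullback 𝓘(ℝ, E) I (extChartAt I x₀).symm σ y := by
  rw [chartForm, mfderivWithin_of_mem_nhds hy]
  rfl

lemma chartForm_smul (c : ℝ) (σ : Form I M k) (x₀ : M) :
    chartForm I (c • σ) x₀ = c • chartForm I σ x₀ := rfl

lemma extD_apply (σ : Form I M k) (x : M) (v : Fin (k + 1) → TangentSpace I x) :
    extD I σ x v = extDerivWithin (chartForm I σ x) (range I) (extChartAt I x x)
      (fun i ↦ (mfderiv I 𝓘(ℝ, E) (extChartAt I x) x : E →L[ℝ] E) (v i)) := rfl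

lemma IsSymplectic.smul {σ : Form I M 2} (h : IsSymplectic I σ) {c : ℝ} (hc : c ≠ 0) :
    IsSymplectic I (c • σ) where
  smooth x₀ := by
    rw [chartForm_smul]
    exact (h.smooth x₀).const_smul c
  closed x := by
    have hd : extDerivWithin (chartForm I (c • σ) x) (range I) (extChartAt I x x) =
        c • extDerivWithin (chartForm I σ x) (range I) (extChartAt I x x) := by
      rw [chartForm_smul, extDerivWithin_smul]
      exact I.uniqueDiffWithinAt_image
    ext v
    have hv := DFunLike.congr_fun (h.closed x) v
    rw [extD_apply] at hv ⊢
    rw [hd]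
    exact (congrArg (c * ·) hv).trans (mul_zero c)
  nondegenerate x u hu := h.nondegenerate x u fun v ↦
    (mul_eq_zero.1 (show c * σ x ![u, v] = 0 from hu v)).resolve_left hc

end Pullback

/-! ### Forms transported through pushed charts -/

section PushForm

variable {E : Type*} [NormedAddCommGroup E] [NormedSpace ℝ E]
  {H : Type*} [TopologicalSpace H] {I : ModelWithCorners ℝ E H}
  {M : Type*} [TopologicalSpace M] [ChartedSpace H M]
  {X : Type*} [TopologicalSpace X] [ChartedSpace E X]
  {Φ : OpenPartialHomeomorph M X}

lemma mdifferentiableAt_of_pushChart_mem (hΦ : Φ.source ⊆ I.interior M)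
    (hX : ∀ s, pushChart I Φ s ∈ IsManifold.maximalAtlas 𝓘(ℝ, E) ∞ X) {x : M}
    (hx : x ∈ Φ.source) : MDifferentiableAt I 𝓘(ℝ, E) Φ x :=
  ((contMDiffOn_of_pushChart_mem hΦ hX).contMDiffAt
    (Φ.open_source.mem_nhds hx)).mdifferentiableAt (by simp)

lemma mdifferentiableAt_symm_of_pushChart_mem [IsManifold I ∞ M]
    (hΦ : Φ.source ⊆ I.interior M)
    (hX : ∀ s, pushChart I Φ s ∈ IsManifold.maximalAtlas 𝓘(ℝ, E) ∞ X) {z : X}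
    (hz : z ∈ Φ.target) : MDifferentiableAt 𝓘(ℝ, E) I Φ.symm z :=
  ((contMDiffOn_symm_of_pushChart_mem hΦ hX).contMDiffAt
    (Φ.open_target.mem_nhds hz)).mdifferentiableAt (by simp)

/-- The inverse of the pushed chart is `Φ` after the inverse chart of `M`, and pulling back by
`Φ.symm` cancels that `Φ`. Equality of the coordinate expressions transfers smoothness and
closedness directly, with no need for naturality of the exterior derivative. -/
lemma chartForm_eq_of_pushChart [IsManifold I ∞ M] {k : ℕ} (hΦ : Φ.source ⊆ I.interior M)
    (hX : ∀ s, pushChart I Φ s ∈ IsManifold.maximalAtlas 𝓘(ℝ, E) ∞ X)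
    {τ : Form I M k} {σ : Form 𝓘(ℝ, E) X k}
    (hσ : ∀ z ∈ Φ.target, σ z = pullback 𝓘(ℝ, E) I Φ.symm τ z) {s : M} {z : X}
    (hz : chartAt E z = pushChart I Φ s) {y : E} (hy : y ∈ (pushChart I Φ s).target) :
    chartForm 𝓘(ℝ, E) σ z y = chartForm I τ s y := by
  obtain ⟨hy₁, hy₂, hy₃⟩ := mem_pushChart_target.1 hy
  have hy₁' : range I ∈ 𝓝 y := mem_interior_iff_mem_nhds.1 hy₁
  have hf : MDifferentiableAt 𝓘(ℝ, E) I (extChartAt I s).symm y :=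
    ((contMDiffWithinAt_extChartAt_symm_range (n := ∞) s hy₂).contMDiffAt
      hy₁').mdifferentiableAt (by simp)
  have hsymm : ⇑(extChartAt 𝓘(ℝ, E) z).symm = Φ ∘ (extChartAt I s).symm := by
    rw [extChartAt, hz]
    rfl
  have hΦd := mdifferentiableAt_of_pushChart_mem hΦ hX hy₃
  have hΦs := mdifferentiableAt_symm_of_pushChart_mem hΦ hX (Φ.map_source hy₃)
  refine (chartForm_eq_pullback σ z (by simp)).trans
    (Eq.trans ?_ (chartForm_eq_pullback τ s hy₁').symm)
  rw [hsymm]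
  refine (pullback_congr_form (I := 𝓘(ℝ, E)) (f := Φ ∘ (extChartAt I s).symm) (x := y)
    (hσ _ (Φ.map_source hy₃))).trans ?_
  refine (pullback_comp (f := Φ ∘ (extChartAt I s).symm) τ hΦs (hΦd.comp _ hf)).symm.trans ?_
  refine (pullback_comp (I' := I) (g := Φ.symm ∘ Φ) τ (hΦs.comp _ hΦd) hf).trans ?_
  exact pullback_congr_form (I' := I) (pullback_eq_self τ (Φ.eventually_left_inverse hy₃))

/-- The two coordinate expressions have the same germ, and at an interior point the derivative
within `range I` is the full derivative. The chart has invertible differential, so `extD I τ = 0` at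
the point already forces the derivative in coordinates to vanish. -/
lemma extD_eq_zero_of_pushChart [IsManifold I ∞ M] {k : ℕ} (hΦ : Φ.source ⊆ I.interior M)
    (hX : ∀ s, pushChart I Φ s ∈ IsManifold.maximalAtlas 𝓘(ℝ, E) ∞ X)
    {τ : Form I M k} {σ : Form 𝓘(ℝ, E) X k}
    (hσ : ∀ z ∈ Φ.target, σ z = pullback 𝓘(ℝ, E) I Φ.symm τ z) {z : X} (hzt : z ∈ Φ.target)
    (hz : chartAt E z = pushChart I Φ (Φ.symm z)) (hτ : extD I τ (Φ.symm z) = 0) :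
    extD 𝓘(ℝ, E) σ z = 0 := by
  set s := Φ.symm z with hs
  have hsΦ : s ∈ Φ.source := Φ.map_target hzt
  have hpt : extChartAt 𝓘(ℝ, E) z z = extChartAt I s s := by
    rw [extChartAt, hz]
    rfl
  have hmem : extChartAt I s s ∈ (pushChart I Φ s).target :=
    mem_pushChart_target.2 ⟨hΦ hsΦ, mem_extChartAt_target s, by simpa using hsΦ⟩
  have hev : chartForm 𝓘(ℝ, E) σ z =ᶠ[𝓝 (extChartAt I s s)] chartForm I τ s := by
    filter_upwards [(pushChart I Φ s).open_target.mem_nhds hmem] with y hy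
    exact chartForm_eq_of_pushChart hΦ hX hσ hz hy
  have hinv := isInvertible_mfderiv_extChartAt (I := I) (mem_extChartAt_source (I := I) s)
  have hzero : extDerivWithin (chartForm I τ s) (range I) (extChartAt I s s) = 0 := by
    ext v
    obtain ⟨A, hA⟩ := hinv
    have h := DFunLike.congr_fun hτ (fun i ↦ A.symm (v i))
    rw [extD_apply] at h
    refine Eq.trans (congrArg _ ?_) h
    funext i
    rw [← hA]
    exact (A.apply_symm_apply (v i)).symm
  rw [extDerivWithin, fderivWithin_of_mem_nhds (range_mem_nhds_isInteriorPoint (hΦ hsΦ))] at hzero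
  ext v
  rw [extD_apply, hpt, hev.extDerivWithin_eq_nhds, extDerivWithin,
    fderivWithin_of_mem_nhds (by simp), hzero]
  rfl

/-- The differentials of `Φ` and `Φ.symm` are mutually inverse, so a vector in the kernel of `σ z`
is carried into the kernel of `τ`. -/
lemma nondegenerate_of_pushChart [IsManifold I ∞ M] (hΦ : Φ.source ⊆ I.interior M)
    (hX : ∀ s, pushChart I Φ s ∈ IsManifold.maximalAtlas 𝓘(ℝ, E) ∞ X)
    {τ : Form I M 2} {σ : Form 𝓘(ℝ, E) X 2} {z : X} (hzt : z ∈ Φ.target)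
    (hσ : σ z = pullback 𝓘(ℝ, E) I Φ.symm τ z)
    (hτ : ∀ u : TangentSpace I (Φ.symm z), (∀ v, τ (Φ.symm z) ![u, v] = 0) → u = 0)
    (u : TangentSpace 𝓘(ℝ, E) z) (hu : ∀ v, σ z ![u, v] = 0) : u = 0 := by
  have h₁ := mdifferentiableAt_symm_of_pushChart_mem hΦ hX hzt
  have h₂ := mdifferentiableAt_of_pushChart_mem hΦ hX (Φ.map_target hzt)
  have h₃ : MDifferentiableAt 𝓘(ℝ, E) I Φ.symm (Φ (Φ.symm z)) := by rwa [Φ.right_inv hzt]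
  have hleft : (mfderiv I 𝓘(ℝ, E) Φ (Φ.symm z)).comp (mfderiv 𝓘(ℝ, E) I Φ.symm z) =
      ContinuousLinearMap.id ℝ _ := by
    have hid : Φ ∘ Φ.symm =ᶠ[𝓝 z] id := Φ.eventually_right_inverse hzt
    exact (mfderiv_comp z h₂ h₁).symm.trans (hid.mfderiv_eq.trans mfderiv_id)
  have hright : (mfderiv 𝓘(ℝ, E) I Φ.symm z : E →L[ℝ] E).comp
      (mfderiv I 𝓘(ℝ, E) Φ (Φ.symm z)) = ContinuousLinearMap.id ℝ E := by
    have h := mfderiv_comp (Φ.symm z) h₃ h₂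
    have hid : Φ.symm ∘ Φ =ᶠ[𝓝 (Φ.symm z)] id :=
      Φ.eventually_left_inverse (Φ.map_target hzt)
    rw [Φ.right_inv hzt] at h
    exact h.symm.trans (hid.mfderiv_eq.trans mfderiv_id)
  have hDu : (mfderiv 𝓘(ℝ, E) I Φ.symm z : E →L[ℝ] E) u = 0 := by
    refine hτ _ fun v ↦ ?_
    have h := hu ((mfderiv I 𝓘(ℝ, E) Φ (Φ.symm z) : E →L[ℝ] E) v)
    rw [hσ, pullback, ContinuousAlternatingMap.compContinuousLinearMap_apply] at h
    convert h using 2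
    funext i
    fin_cases i
    · rfl
    · exact (DFunLike.congr_fun hright v).symm
  have h := DFunLike.congr_fun hleft u
  have h' : (mfderiv I 𝓘(ℝ, E) Φ (Φ.symm z) : E →L[ℝ] E)
    ((mfderiv 𝓘(ℝ, E) I Φ.symm z : E →L[ℝ] E) u) = u := h
  rw [hDu, map_zero] at h'
  exact h'.symm

end PushForm

/-! ### Immersions in codimension zero -/

section Immersion

variable {E : Type*} [NormedAddCommGroup E] [NormedSpace ℝ E]
  {H : Type*} [TopologicalSpace H] {I : ModelWithCorners ℝ E H}
  {M : Type*} [TopologicalSpace M] [ChartedSpace H M]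
  {X : Type*} [TopologicalSpace X] [ChartedSpace E X]

/-- Source and target have the same model vector space, so the complement is trivial, and the normal
form `y ↦ (y, 0)` of an immersion is just the inclusion of `range I` in `E`. -/
lemma isImmersionAt_of_charts {φ : M → X} {x : M} (hφ : ContinuousAt φ x)
    {d : OpenPartialHomeomorph M H} {e : OpenPartialHomeomorph X E}
    (hd : d ∈ IsManifold.maximalAtlas I ∞ M) (he : e ∈ IsManifold.maximalAtlas 𝓘(ℝ, E) ∞ X)
    (hx : x ∈ d.source) (hx' : φ x ∈ e.source) (h : ∀ y ∈ d.source, e (φ y) = I (d y)) :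
    Manifold.IsImmersionAtOfComplement PUnit.{1} I 𝓘(ℝ, E) ∞ φ x := by
  refine .mk_of_continuousAt hφ (ContinuousLinearEquiv.prodUnique ℝ E PUnit) d e hx hx' hd he ?_
  intro y hy
  have hy' : (d.extend I).symm y ∈ d.source := by
    simpa using (d.extend I).map_target hy
  have h₁ : (d.extend I) ((d.extend I).symm y) = y := (d.extend I).right_inv hy
  have h₂ := h _ hy'
  exact h₂.trans h₁

lemma isImmersionAt_of_pushChart_mem [IsManifold I ∞ M] {Φ : OpenPartialHomeomorph M X}
    (hΦ : Φ.source ⊆ I.interior M)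
    (hX : ∀ s, pushChart I Φ s ∈ IsManifold.maximalAtlas 𝓘(ℝ, E) ∞ X) {x : M}
    (hx : x ∈ Φ.source) : Manifold.IsImmersionAtOfComplement PUnit.{1} I 𝓘(ℝ, E) ∞ Φ x := by
  refine isImmersionAt_of_charts (d := (chartAt H x).restr Φ.source) (e := pushChart I Φ x)
    (Φ.continuousAt hx) ?_ (hX x) ?_ (mem_pushChart_source_self hΦ hx) ?_
  · exact restr_mem_maximalAtlas _ (IsManifold.chart_mem_maximalAtlas x) Φ.open_source
  · rw [OpenPartialHomeomorph.restr_source' _ _ Φ.open_source]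
    exact ⟨mem_chart_source H x, hx⟩
  · intro y hy
    rw [OpenPartialHomeomorph.restr_source' _ _ Φ.open_source] at hy
    rw [pushChart_apply, Φ.left_inv hy.2]
    rfl

end Immersion

/-! ### Charts adapted to collars and cylinders -/

section Cylinder

variable {E : Type*} [NormedAddCommGroup E] [NormedSpace ℝ E]
  {E₀ : Type*} [NormedAddCommGroup E₀] [NormedSpace ℝ E₀]
  {C : Type*} [TopologicalSpace C] {X : Type*} [TopologicalSpace X]

/-- The chart of `X` obtained from an identification of an open subset of `X` with an open subset of
`C × ℝ`, and a chart of `C`. -/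
def cylinderChart (K : OpenPartialHomeomorph X (C × ℝ)) (c : OpenPartialHomeomorph C E₀)
    (L : (E₀ × ℝ) ≃L[ℝ] E) : OpenPartialHomeomorph X E :=
  K.trans ((c.prod (OpenPartialHomeomorph.refl ℝ)).trans
    L.toHomeomorph.toOpenPartialHomeomorph)

lemma mem_cylinderChart_source {K : OpenPartialHomeomorph X (C × ℝ)}
    {c : OpenPartialHomeomorph C E₀} {L : (E₀ × ℝ) ≃L[ℝ] E} {z : X} :
    z ∈ (cylinderChart K c L).source ↔ z ∈ K.source ∧ (K z).1 ∈ c.source := by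
  simp [cylinderChart]

end Cylinder

section Collar

variable {E : Type*} [NormedAddCommGroup E] [NormedSpace ℝ E]
  {H : Type*} [TopologicalSpace H] {I : ModelWithCorners ℝ E H}
  {E₀ : Type*} [NormedAddCommGroup E₀] [NormedSpace ℝ E₀]
  {M : Type*} [TopologicalSpace M] [ChartedSpace H M]
  {C : Type*} [TopologicalSpace C] [ChartedSpace E₀ C]
  {X : Type*} [TopologicalSpace X] [ChartedSpace E X]

/-- A smooth identification of an open subset of `M` with `C × (T ∩ [0, ∞))`. -/
structure IsCollar (I : ModelWithCorners ℝ E H) (κ : PartialEquiv M (C × ℝ)) (T : Set ℝ) :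
    Prop where
  isOpen : IsOpen T
  isOpen_source : IsOpen κ.source
  target_eq : κ.target = univ ×ˢ (T ∩ Ici 0)
  contMDiffOn : ContMDiffOn I (𝓘(ℝ, E₀).prod 𝓘(ℝ, ℝ)) ∞ κ κ.source
  contMDiffOn_symm : ContMDiffOn (𝓘(ℝ, E₀).prod 𝓘(ℝ, ℝ)) I ∞ κ.symm κ.target

/-- The chart of `M` obtained from a collar and a chart of `C`, given a splitting of the model space
which identifies the model of `M` with a half-space. -/
def collarChart {κ : PartialEquiv M (C × ℝ)} {T : Set ℝ} (hκ : IsCollar (E₀ := E₀) I κ T)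
    (c : OpenPartialHomeomorph C E₀) (L : (E₀ × ℝ) ≃L[ℝ] E)
    (hL : ∀ p, L p ∈ range I ↔ 0 ≤ p.2) : OpenPartialHomeomorph M H where
  toFun x := I.symm (L (c (κ x).1, (κ x).2))
  invFun y := κ.symm (c.symm (L.symm (I y)).1, (L.symm (I y)).2)
  source := κ.source ∩ κ ⁻¹' (c.source ×ˢ univ)
  target := {y | (L.symm (I y)).1 ∈ c.target ∧ (L.symm (I y)).2 ∈ T}
  map_source' x hx := by
    have hT : κ x ∈ univ ×ˢ (T ∩ Ici 0) := hκ.target_eq ▸ κ.map_source hx.1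
    rw [mem_ofPred_eq, I.right_inv ((hL (_, _)).2 hT.2.2), L.symm_apply_apply]
    exact ⟨c.map_source hx.2.1, hT.2.1⟩
  map_target' y hy := by
    have h0 : 0 ≤ (L.symm (I y)).2 := (hL _).1 (by simp)
    have hT : (c.symm (L.symm (I y)).1, (L.symm (I y)).2) ∈ κ.target := by
      rw [hκ.target_eq]
      exact ⟨mem_univ _, hy.2, h0⟩
    refine ⟨κ.map_target hT, ?_⟩
    rw [mem_preimage, κ.right_inv hT]
    exact ⟨c.map_target hy.1, mem_univ _⟩
  left_inv' x hx := by
    have hT : κ x ∈ univ ×ˢ (T ∩ Ici 0) := hκ.target_eq ▸ κ.map_source hx.1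
    rw [I.right_inv ((hL (_, _)).2 hT.2.2), L.symm_apply_apply, c.left_inv hx.2.1, κ.left_inv hx.1]
  right_inv' y hy := by
    have h0 : 0 ≤ (L.symm (I y)).2 := (hL _).1 (by simp)
    have hT : (c.symm (L.symm (I y)).1, (L.symm (I y)).2) ∈ κ.target := by
      rw [hκ.target_eq]
      exact ⟨mem_univ _, hy.2, h0⟩
    rw [κ.right_inv hT, c.right_inv hy.1, L.apply_symm_apply, I.left_inv]
  open_source := hκ.contMDiffOn.continuousOn.isOpen_inter_preimage hκ.isOpen_source
    (c.open_source.prod isOpen_univ)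
  open_target := by
    have h : Continuous fun y ↦ L.symm (I y) := L.symm.continuous.comp I.continuous
    exact (c.open_target.preimage h.fst).inter (hκ.isOpen.preimage h.snd)
  continuousOn_toFun := by
    have h := hκ.contMDiffOn.continuousOn.mono (inter_subset_left
      (t := κ ⁻¹' (c.source ×ˢ univ)))
    exact I.continuous_symm.comp_continuousOn (L.continuous.comp_continuousOn
      ((c.continuousOn.comp h.fst fun x hx ↦ hx.2.1).prodMk h.snd))
  continuousOn_invFun := by
    have h : Continuous fun y ↦ L.symm (I y) := L.symm.continuous.comp I.continuous
    refine hκ.contMDiffOn_symm.continuousOn.comp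
      ((c.continuousOn_symm.comp h.fst.continuousOn fun y hy ↦ hy.1).prodMk
        h.snd.continuousOn) fun y hy ↦ ?_
    rw [hκ.target_eq]
    exact ⟨mem_univ _, hy.2, (hL _).1 (by simp)⟩

lemma collarChart_mem_maximalAtlas [IsManifold I ∞ M] {κ : PartialEquiv M (C × ℝ)} {T : Set ℝ}
    (hκ : IsCollar (E₀ := E₀) I κ T) {c : OpenPartialHomeomorph C E₀}
    (hc : c ∈ IsManifold.maximalAtlas 𝓘(ℝ, E₀) ∞ C) (L : (E₀ × ℝ) ≃L[ℝ] E)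
    (hL : ∀ p, L p ∈ range I ↔ 0 ≤ p.2) :
    collarChart hκ c L hL ∈ IsManifold.maximalAtlas I ∞ M := by
  have hc₁ := contMDiffOn_of_mem_maximalAtlas hc
  have hc₂ := contMDiffOn_symm_of_mem_maximalAtlas hc
  refine OpenPartialHomeomorph.mem_maximalAtlas_of_contMDiffOn _ ?_ ?_
  · have h := hκ.contMDiffOn.mono (inter_subset_left (t := κ ⁻¹' (c.source ×ˢ univ)))
    have h₁ := hc₁.comp (contMDiff_fst.comp_contMDiffOn h) fun x hx ↦ hx.2.1
    refine I.contMDiffOn_symm.comp (L.contDiff.contMDiff.comp_contMDiffOn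
      (h₁.prodMk_space (contMDiff_snd.comp_contMDiffOn h))) fun x hx ↦ (hL _).2 ?_
    have hT : κ x ∈ univ ×ˢ (T ∩ Ici 0) := hκ.target_eq ▸ κ.map_source hx.1
    exact hT.2.2
  · have h : ContMDiff I 𝓘(ℝ, E₀ × ℝ) ∞ fun y ↦ L.symm (I y) :=
      L.symm.contDiff.contMDiff.comp I.contMDiff
    have h₁ : ContMDiff I 𝓘(ℝ, E₀) ∞ fun y ↦ (L.symm (I y)).1 :=
      contDiff_fst.contMDiff.comp h
    have h₂ : ContMDiff I 𝓘(ℝ, ℝ) ∞ fun y ↦ (L.symm (I y)).2 :=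
      contDiff_snd.contMDiff.comp h
    refine hκ.contMDiffOn_symm.comp
      ((hc₂.comp h₁.contMDiffOn fun y hy ↦ hy.1).prodMk h₂.contMDiffOn) fun y hy ↦ ?_
    rw [hκ.target_eq]
    exact ⟨mem_univ _, hy.2, (hL _).1 (by simp)⟩

lemma cylinderChart_mem_maximalAtlas [IsManifold 𝓘(ℝ, E) ∞ X] {K : OpenPartialHomeomorph X (C × ℝ)}
    (hK : ContMDiffOn 𝓘(ℝ, E) (𝓘(ℝ, E₀).prod 𝓘(ℝ, ℝ)) ∞ K K.source)
    (hK' : ContMDiffOn (𝓘(ℝ, E₀).prod 𝓘(ℝ, ℝ)) 𝓘(ℝ, E) ∞ K.symm K.target)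
    {c : OpenPartialHomeomorph C E₀} (hc : c ∈ IsManifold.maximalAtlas 𝓘(ℝ, E₀) ∞ C)
    (L : (E₀ × ℝ) ≃L[ℝ] E) :
    cylinderChart K c L ∈ IsManifold.maximalAtlas 𝓘(ℝ, E) ∞ X := by
  have hc₁ := contMDiffOn_of_mem_maximalAtlas hc
  have hc₂ := contMDiffOn_symm_of_mem_maximalAtlas hc
  refine OpenPartialHomeomorph.mem_maximalAtlas_of_contMDiffOn _ ?_ ?_
  · have h := hK.mono fun z hz ↦ ((mem_cylinderChart_source (c := c) (L := L)).1 hz).1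
    have h₁ := hc₁.comp (contMDiff_fst.comp_contMDiffOn h)
      fun z hz ↦ (mem_cylinderChart_source.1 hz).2
    exact L.contDiff.contMDiff.comp_contMDiffOn
      (h₁.prodMk_space (contMDiff_snd.comp_contMDiffOn h))
  · have ht : ∀ y ∈ (cylinderChart K c L).target, (L.symm y).1 ∈ c.target ∧
        (c.symm (L.symm y).1, (L.symm y).2) ∈ K.target := by
      intro y hy
      simpa [cylinderChart] using hy
    have h₁ : ContMDiff 𝓘(ℝ, E) 𝓘(ℝ, E₀) ∞ fun y ↦ (L.symm y).1 :=
      (contDiff_fst.comp L.symm.contDiff).contMDiff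
    have h₂ : ContMDiff 𝓘(ℝ, E) 𝓘(ℝ, ℝ) ∞ fun y ↦ (L.symm y).2 :=
      (contDiff_snd.comp L.symm.contDiff).contMDiff
    exact hK'.comp ((hc₂.comp h₁.contMDiffOn fun y hy ↦ (ht y hy).1).prodMk h₂.contMDiffOn)
      fun y hy ↦ (ht y hy).2

/-- A map which, in suitable collars, is the inclusion of `C × [0, ε)` in `C × ℝ` is an
immersion. -/
lemma isImmersionAt_of_collar [IsManifold I ∞ M] [IsManifold 𝓘(ℝ, E) ∞ X]
    [IsManifold 𝓘(ℝ, E₀) ∞ C] {κ : PartialEquiv M (C × ℝ)}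
    {T : Set ℝ} (hκ : IsCollar (E₀ := E₀) I κ T) {K : OpenPartialHomeomorph X (C × ℝ)}
    (hK : ContMDiffOn 𝓘(ℝ, E) (𝓘(ℝ, E₀).prod 𝓘(ℝ, ℝ)) ∞ K K.source)
    (hK' : ContMDiffOn (𝓘(ℝ, E₀).prod 𝓘(ℝ, ℝ)) 𝓘(ℝ, E) ∞ K.symm K.target)
    (L : (E₀ × ℝ) ≃L[ℝ] E) (hL : ∀ p, L p ∈ range I ↔ 0 ≤ p.2) {φ : M → X}
    {x : M} (hφ : ContinuousAt φ x) (hx : x ∈ κ.source) (hφx : φ x ∈ K.source) {W : Set M}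
    (hW : IsOpen W) (hxW : x ∈ W) (h : ∀ y ∈ W, K (φ y) = κ y) :
    Manifold.IsImmersionAtOfComplement PUnit.{1} I 𝓘(ℝ, E) ∞ φ x := by
  have hc := IsManifold.chart_mem_maximalAtlas (I := 𝓘(ℝ, E₀)) (n := ∞) (κ x).1
  refine isImmersionAt_of_charts (d := (collarChart hκ (chartAt E₀ (κ x).1) L hL).restr W)
    (e := cylinderChart K (chartAt E₀ (κ x).1) L) hφ ?_
    (cylinderChart_mem_maximalAtlas hK hK' hc L) ?_ ?_ ?_
  · exact restr_mem_maximalAtlas _ (collarChart_mem_maximalAtlas hκ hc L hL) hW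
  · rw [OpenPartialHomeomorph.restr_source' _ _ hW]
    exact ⟨⟨hx, mem_chart_source E₀ _, mem_univ _⟩, hxW⟩
  · rw [mem_cylinderChart_source, h x hxW]
    exact ⟨hφx, mem_chart_source E₀ _⟩
  · intro y hy
    rw [OpenPartialHomeomorph.restr_source' _ _ hW] at hy
    have hT : κ y ∈ univ ×ˢ (T ∩ Ici 0) := hκ.target_eq ▸ κ.map_source hy.1.1
    change L (chartAt E₀ (κ x).1 (K (φ y)).1, (K (φ y)).2) =
      I (I.symm (L (chartAt E₀ (κ x).1 (κ y).1, (κ y).2)))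
    rw [h y hy.2, I.right_inv ((hL (_, _)).2 hT.2.2)]

end Collar

/-! ### Smooth structure on the glued space -/

section GlueManifold

variable {E : Type*} [NormedAddCommGroup E] [NormedSpace ℝ E]
  {H : Type*} [TopologicalSpace H] {I : ModelWithCorners ℝ E H}
  {M : Type u} [TopologicalSpace M] [ChartedSpace H M]
  {N : Type v} [TopologicalSpace N] [ChartedSpace H N]

/-- The partial bijection `r` is given, on the open neighbourhood `W` of the boundary, by the smooth
map `g` into the interior of `N`, and every point of `M` which is related to an interior point of `N`
lies in `W`. -/
structure IsSmoothTransition (I : ModelWithCorners ℝ E H) (r : M → N → Prop) (W : Set M)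
    (g : M → N) : Prop where
  isOpen : IsOpen W
  boundary_subset : I.boundary M ⊆ W
  contMDiffOn : ContMDiffOn I I ∞ g W
  rel : ∀ x ∈ W, r x (g x)
  mapsTo : MapsTo g W (I.interior N)
  mem_of_rel : ∀ {x y}, r x y → y ∈ I.interior N → x ∈ W

variable {r : M → N → Prop} (hr : IsPartialBijection r) {W₁ : Set M} {W₂ : Set N} {g₁ : M → N}
  {g₂ : N → M}

lemma Glue.inl_eq_inr_of_mem (h : IsSmoothTransition I r W₁ g₁) {x : M} (hx : x ∈ W₁) :
    Glue.inl hr x = Glue.inr hr (g₁ x) := (Glue.inl_eq_inr hr).2 (h.rel x hx)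

lemma Glue.inr_eq_inl_of_mem (h : IsSmoothTransition I (flip r) W₂ g₂) {y : N} (hy : y ∈ W₂) :
    Glue.inr hr y = Glue.inl hr (g₂ y) := ((Glue.inl_eq_inr hr).2 (h.rel y hy)).symm

/-- The restriction to the interior is essential: every point of `N` glued to an interior point of
`M` lies in the open set `W₂`, so the trace of the image on `N` is `W₂ ∩ g₂ ⁻¹' U`. -/
lemma Glue.isOpen_image_inl (h : IsSmoothTransition I (flip r) W₂ g₂) {U : Set M}
    (hU : IsOpen U) (hUI : U ⊆ I.interior M) : IsOpen (Glue.inl hr '' U) := by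
  rw [Glue.isOpen_iff, (Glue.inl_injective hr).preimage_image]
  refine ⟨hU, ?_⟩
  have : Glue.inr hr ⁻¹' (Glue.inl hr '' U) = W₂ ∩ g₂ ⁻¹' U := by
    ext y
    constructor
    · rintro ⟨x, hx, hxy⟩
      have hxy' := (Glue.inl_eq_inr hr).1 hxy
      have hy : y ∈ W₂ := h.mem_of_rel (y := x) hxy' (hUI hx)
      refine ⟨hy, ?_⟩
      rwa [mem_preimage, ← hr.left_unique hxy' (h.rel y hy)]
    · rintro ⟨hy, hyU⟩
      exact ⟨g₂ y, hyU, (Glue.inr_eq_inl_of_mem hr h hy).symm⟩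
  rw [this]
  exact h.contMDiffOn.continuousOn.isOpen_inter_preimage h.isOpen hU

lemma Glue.isOpen_image_inr (h : IsSmoothTransition I r W₁ g₁) {U : Set N}
    (hU : IsOpen U) (hUI : U ⊆ I.interior N) : IsOpen (Glue.inr hr '' U) := by
  rw [Glue.isOpen_iff, (Glue.inr_injective hr).preimage_image]
  refine ⟨?_, hU⟩
  have : Glue.inl hr ⁻¹' (Glue.inr hr '' U) = W₁ ∩ g₁ ⁻¹' U := by
    ext x
    constructor
    · rintro ⟨y, hy, hxy⟩
      have hxy' := (Glue.inl_eq_inr hr).1 hxy.symm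
      have hx : x ∈ W₁ := h.mem_of_rel hxy' (hUI hy)
      refine ⟨hx, ?_⟩
      rwa [mem_preimage, ← hr.right_unique hxy' (h.rel x hx)]
    · rintro ⟨hx, hxU⟩
      exact ⟨g₁ x, hxU, (Glue.inl_eq_inr_of_mem hr h hx).symm⟩
  rw [this]
  exact h.contMDiffOn.continuousOn.isOpen_inter_preimage h.isOpen hU

/-- A continuous injective map which is open on the open set `O`, as an open partial homeomorphism
with source `O`. -/
def partialHomeomorphOfInjective {A B : Type*} [TopologicalSpace A] [TopologicalSpace B]
    [Nonempty A] (f : A → B) (hf : Continuous f) (hinj : Function.Injective f) {O : Set A}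
    (hO : IsOpen O) (ho : ∀ U, IsOpen U → U ⊆ O → IsOpen (f '' U)) :
    OpenPartialHomeomorph A B :=
  .ofContinuousOpenRestrict (hinj.injOn.toPartialEquiv f O) hf.continuousOn
    (fun U hU ↦ by
      have := ho (Subtype.val '' U) (hO.isOpenMap_subtype_val U hU)
        (by rintro _ ⟨x, -, rfl⟩; exact x.2)
      rwa [image_image] at this) hO

/-- Two compact manifolds with boundary, glued along a smooth partial bijection of collars, form a
manifold without boundary. -/
theorem exists_chartedSpace_glue [IsManifold I ∞ M] [IsManifold I ∞ N] [Nonempty M] [Nonempty N]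
    (h₁ : IsSmoothTransition I r W₁ g₁) (h₂ : IsSmoothTransition I (flip r) W₂ g₂) :
    ∃ (_ : ChartedSpace E (Glue hr)) (_ : IsManifold 𝓘(ℝ, E) ∞ (Glue hr))
      (Φ : OpenPartialHomeomorph M (Glue hr)) (Ψ : OpenPartialHomeomorph N (Glue hr)),
      Φ.source = I.interior M ∧ Ψ.source = I.interior N ∧
      Φ = Glue.inl hr ∧ Ψ = Glue.inr hr ∧
      (∀ s, pushChart I Φ s ∈ IsManifold.maximalAtlas 𝓘(ℝ, E) ∞ (Glue hr)) ∧
      (∀ s, pushChart I Ψ s ∈ IsManifold.maximalAtlas 𝓘(ℝ, E) ∞ (Glue hr)) ∧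
      ∀ z, (z ∈ Φ.target ∧ chartAt E z = pushChart I Φ (Φ.symm z)) ∨
        (z ∈ Ψ.target ∧ chartAt E z = pushChart I Ψ (Ψ.symm z)) := by
  have hOM : IsOpen (I.interior M) := I.isOpen_interior (n := ∞) (by simp)
  have hON : IsOpen (I.interior N) := I.isOpen_interior (n := ∞) (by simp)
  let Φ : OpenPartialHomeomorph M (Glue hr) := partialHomeomorphOfInjective (Glue.inl hr)
    (Glue.continuous_inl hr) (Glue.inl_injective hr) hOM
    fun U hU hUI ↦ Glue.isOpen_image_inl hr h₂ hU hUI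
  let Ψ : OpenPartialHomeomorph N (Glue hr) := partialHomeomorphOfInjective (Glue.inr hr)
    (Glue.continuous_inr hr) (Glue.inr_injective hr) hON
    fun U hU hUI ↦ Glue.isOpen_image_inr hr h₁ hU hUI
  have hΦs : Φ.source = I.interior M := rfl
  have hΨs : Ψ.source = I.interior N := rfl
  have hΦc : ⇑Φ = Glue.inl hr := rfl
  have hΨc : ⇑Ψ = Glue.inr hr := rfl
  have hΦt : Φ.target = Glue.inl hr '' I.interior M := rfl
  have hΨt : Ψ.target = Glue.inr hr '' I.interior N := rfl
  have hcover : Φ.target ∪ Ψ.target = univ := by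
    rw [eq_univ_iff_forall]
    intro z
    rcases Glue.exists_rep hr z with ⟨x, rfl⟩ | ⟨y, rfl⟩
    · by_cases hx : x ∈ I.interior M
      · exact .inl ⟨x, hx, rfl⟩
      -- A boundary point of `M` is glued to an interior point of `N`, so no chart at the boundary
      -- is needed.
      · rw [← mem_compl_iff, I.compl_interior] at hx
        have hxW := h₁.boundary_subset hx
        exact .inr ⟨g₁ x, h₁.mapsTo hxW, (Glue.inl_eq_inr_of_mem hr h₁ hxW).symm⟩
    · by_cases hy : y ∈ I.interior N
      · exact .inr ⟨y, hy, rfl⟩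
      · rw [← mem_compl_iff, I.compl_interior] at hy
        have hyW := h₂.boundary_subset hy
        exact .inl ⟨g₂ y, h₂.mapsTo hyW, (Glue.inr_eq_inl_of_mem hr h₂ hyW).symm⟩
  have hΦΨ : ContMDiffOn I I ∞ (Φ.trans Ψ.symm) (Φ.trans Ψ.symm).source := by
    have hW : (Φ.trans Ψ.symm).source ⊆ W₁ := by
      rintro x ⟨-, y, hy, hxy⟩
      exact h₁.mem_of_rel ((Glue.inl_eq_inr hr).1 hxy.symm) hy
    refine (h₁.contMDiffOn.mono hW).congr fun x hx ↦ ?_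
    change Ψ.symm (Glue.inl hr x) = _
    rw [Glue.inl_eq_inr_of_mem hr h₁ (hW hx)]
    exact Ψ.left_inv (h₁.mapsTo (hW hx))
  have hΨΦ : ContMDiffOn I I ∞ (Ψ.trans Φ.symm) (Ψ.trans Φ.symm).source := by
    have hW : (Ψ.trans Φ.symm).source ⊆ W₂ := by
      rintro y ⟨-, x, hx, hxy⟩
      exact h₂.mem_of_rel (y := x) ((Glue.inl_eq_inr hr).1 hxy) hx
    refine (h₂.contMDiffOn.mono hW).congr fun y hy ↦ ?_
    change Φ.symm (Glue.inr hr y) = _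
    rw [Glue.inr_eq_inl_of_mem hr h₂ (hW hy)]
    exact Φ.left_inv (h₂.mapsTo (hW hy))
  let cs := gluedChartedSpace Φ Ψ hΦs.subset hΨs.subset hcover
  have hman : IsManifold 𝓘(ℝ, E) ∞ (Glue hr) :=
    isManifold_gluedChartedSpace Φ Ψ hΦs.subset hΨs.subset hcover hΦΨ hΨΦ
  refine ⟨cs, hman, Φ, Ψ, hΦs, hΨs, hΦc, hΨc, fun s ↦ ?_, fun s ↦ ?_, fun z ↦ ?_⟩
  · exact IsManifold.subset_maximalAtlas (.inl ⟨s, rfl⟩)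
  · exact IsManifold.subset_maximalAtlas (.inr ⟨s, rfl⟩)
  · by_cases hz : z ∈ Φ.target
    · exact .inl ⟨hz, if_pos hz⟩
    · exact .inr ⟨((eq_univ_iff_forall.1 hcover) z).resolve_left hz, if_neg hz⟩

end GlueManifold

/-! ### Gluing the symplectic forms -/

section GlueForm

variable {E : Type*} [NormedAddCommGroup E] [NormedSpace ℝ E]
  {H : Type*} [TopologicalSpace H] {I : ModelWithCorners ℝ E H}
  {M : Type*} [TopologicalSpace M] [ChartedSpace H M]
  {N : Type*} [TopologicalSpace N] [ChartedSpace H N]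
  {X : Type*} [TopologicalSpace X] [ChartedSpace E X]

/-- Symplectic forms on two pieces which agree on the overlap define a symplectic form on the glued
manifold. -/
theorem exists_isSymplectic_glue [IsManifold I ∞ M] [IsManifold I ∞ N]
    {Φ : OpenPartialHomeomorph M X} {Ψ : OpenPartialHomeomorph N X}
    (hΦ : Φ.source ⊆ I.interior M) (hΨ : Ψ.source ⊆ I.interior N)
    (hΦX : ∀ s, pushChart I Φ s ∈ IsManifold.maximalAtlas 𝓘(ℝ, E) ∞ X)
    (hΨX : ∀ s, pushChart I Ψ s ∈ IsManifold.maximalAtlas 𝓘(ℝ, E) ∞ X)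
    (hX : ∀ z, (z ∈ Φ.target ∧ chartAt E z = pushChart I Φ (Φ.symm z)) ∨
        (z ∈ Ψ.target ∧ chartAt E z = pushChart I Ψ (Ψ.symm z)))
    {τ₁ : Form I M 2} {τ₂ : Form I N 2} (h₁ : IsSymplectic I τ₁) (h₂ : IsSymplectic I τ₂)
    (h : ∀ z ∈ Φ.target, z ∈ Ψ.target →
      pullback 𝓘(ℝ, E) I Φ.symm τ₁ z = pullback 𝓘(ℝ, E) I Ψ.symm τ₂ z) :
    ∃ σ : Form 𝓘(ℝ, E) X 2, IsSymplectic 𝓘(ℝ, E) σ ∧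
      (∀ z ∈ Φ.target, σ z = pullback 𝓘(ℝ, E) I Φ.symm τ₁ z) ∧
      ∀ z ∈ Ψ.target, σ z = pullback 𝓘(ℝ, E) I Ψ.symm τ₂ z := by
  classical
  let σ : Form 𝓘(ℝ, E) X 2 := fun z ↦ if z ∈ Φ.target then pullback 𝓘(ℝ, E) I Φ.symm τ₁ z
    else pullback 𝓘(ℝ, E) I Ψ.symm τ₂ z
  have hσ₁ : ∀ z ∈ Φ.target, σ z = pullback 𝓘(ℝ, E) I Φ.symm τ₁ z := fun z hz ↦ if_pos hz
  have hσ₂ : ∀ z ∈ Ψ.target, σ z = pullback 𝓘(ℝ, E) I Ψ.symm τ₂ z := by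
    intro z hz
    by_cases hz' : z ∈ Φ.target
    · rw [hσ₁ z hz', h z hz' hz]
    · exact if_neg hz'
  have htarget : ∀ z : X, (extChartAt 𝓘(ℝ, E) z).target = (chartAt E z).target := fun z ↦ by
    simp
  refine ⟨σ, ⟨fun z ↦ ?_, fun z ↦ ?_, fun z ↦ ?_⟩, hσ₁, hσ₂⟩
  · rw [htarget]
    rcases hX z with ⟨-, hc⟩ | ⟨-, hc⟩ <;> rw [hc]
    · exact ((h₁.smooth _).mono fun y hy ↦ (mem_pushChart_target.1 hy).2.1).congr
        fun y hy ↦ chartForm_eq_of_pushChart hΦ hΦX hσ₁ hc hy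
    · exact ((h₂.smooth _).mono fun y hy ↦ (mem_pushChart_target.1 hy).2.1).congr
        fun y hy ↦ chartForm_eq_of_pushChart hΨ hΨX hσ₂ hc hy
  · rcases hX z with ⟨hz, hc⟩ | ⟨hz, hc⟩
    · exact extD_eq_zero_of_pushChart hΦ hΦX hσ₁ hz hc (h₁.closed _)
    · exact extD_eq_zero_of_pushChart hΨ hΨX hσ₂ hz hc (h₂.closed _)
  · rcases hX z with ⟨hz, hc⟩ | ⟨hz, hc⟩
    · exact nondegenerate_of_pushChart hΦ hΦX hz (hσ₁ z hz) (h₁.nondegenerate _)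
    · exact nondegenerate_of_pushChart hΨ hΨX hz (hσ₂ z hz) (h₂.nondegenerate _)

/-- Let `σ` be the form on `X` which corresponds to `τ` under the parametrization `Ψ`. If `φ` agrees
with `Ψ ∘ g` near `x`, then the pullback of `σ` by `φ` at `x` is that of `τ` by `g`. -/
lemma pullback_eq_pullback_of_eventuallyEq [IsManifold I ∞ N] {k : ℕ}
    {Ψ : OpenPartialHomeomorph N X} (hΨ : Ψ.source ⊆ I.interior N)
    (hΨX : ∀ s, pushChart I Ψ s ∈ IsManifold.maximalAtlas 𝓘(ℝ, E) ∞ X)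
    {τ : Form I N k} {σ : Form 𝓘(ℝ, E) X k}
    (hσ : ∀ z ∈ Ψ.target, σ z = pullback 𝓘(ℝ, E) I Ψ.symm τ z) {φ : M → X} {g : M → N} {x : M}
    (hφ : φ =ᶠ[𝓝 x] Ψ ∘ g) (hg : MDifferentiableAt I I g x) (hgx : g x ∈ Ψ.source) :
    pullback I 𝓘(ℝ, E) φ σ x = pullback I I g τ x := by
  have h₁ := mdifferentiableAt_of_pushChart_mem hΨ hΨX hgx
  have h₂ := mdifferentiableAt_symm_of_pushChart_mem hΨ hΨX (Ψ.map_source hgx)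
  refine (pullback_congr σ hφ).trans ((pullback_comp σ h₁ hg).trans (pullback_congr_form ?_))
  refine (pullback_congr_form (f := Ψ) (hσ _ (Ψ.map_source hgx))).trans ?_
  exact (pullback_comp τ h₂ h₁).symm.trans
    (pullback_eq_self τ (Ψ.eventually_left_inverse hgx))

end GlueForm

/-! ### Homogeneity of the symplectization form -/

section Wedge

variable {F : Type*} [NormedAddCommGroup F] [NormedSpace ℝ F]

lemma wedge_apply (α : F →L[ℝ] ℝ) (β : F [⋀^Fin 1]→L[ℝ] ℝ) (v : Fin 2 → F) :
    wedge α β v = α (v 0) * β ![v 1] - α (v 1) * β ![v 0] := by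
  rw [wedge, ContinuousAlternatingMap.alternatizeUncurryFin_apply, Fin.sum_univ_two]
  have h₀ : (Fin.removeNth 0 v : Fin 1 → F) = ![v 1] := by
    funext i; fin_cases i; rfl
  have h₁ : (Fin.removeNth 1 v : Fin 1 → F) = ![v 0] := by
    funext i; fin_cases i; rfl
  rw [h₀, h₁]
  simp [sub_eq_add_neg]

/-- The factor `μ` comes from `dt` in the first summand and from the coefficient `μ * t` in the
second; forms pulled back from `F` do not see the scaling. -/
lemma wedge_add_comp_prodMap (θ : F [⋀^Fin 1]→L[ℝ] ℝ) (η : F [⋀^Fin 2]→L[ℝ] ℝ) (t μ : ℝ) :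
    (wedge (ContinuousLinearMap.snd ℝ F ℝ)
          (θ.compContinuousLinearMap (ContinuousLinearMap.fst ℝ F ℝ)) +
        (μ * t) • η.compContinuousLinearMap (ContinuousLinearMap.fst ℝ F ℝ)).compContinuousLinearMap
      ((ContinuousLinearMap.id ℝ F).prodMap (μ • ContinuousLinearMap.id ℝ ℝ)) =
    μ • (wedge (ContinuousLinearMap.snd ℝ F ℝ)
          (θ.compContinuousLinearMap (ContinuousLinearMap.fst ℝ F ℝ)) +
        t • η.compContinuousLinearMap (ContinuousLinearMap.fst ℝ F ℝ)) := by
  ext v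
  have h : ∀ u : F × ℝ, (⇑(ContinuousLinearMap.fst ℝ F ℝ) ∘ ![(u.1, μ * u.2)] : Fin 1 → F) =
      ⇑(ContinuousLinearMap.fst ℝ F ℝ) ∘ ![u] := by
    intro u
    funext i
    fin_cases i
    rfl
  have h' : ⇑(ContinuousLinearMap.fst ℝ F ℝ) ∘
      ⇑((ContinuousLinearMap.id ℝ F).prodMap (μ • ContinuousLinearMap.id ℝ ℝ)) ∘ v =
      ⇑(ContinuousLinearMap.fst ℝ F ℝ) ∘ v := rfl
  have hD : ∀ u : F × ℝ, (ContinuousLinearMap.id ℝ F).prodMap (μ • ContinuousLinearMap.id ℝ ℝ) u =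
      (u.1, μ * u.2) := fun u ↦ rfl
  simp only [ContinuousAlternatingMap.compContinuousLinearMap_apply,
    ContinuousAlternatingMap.add_apply, ContinuousAlternatingMap.smul_apply, wedge_apply, h',
    Function.comp_apply, hD, smul_eq_mul, ContinuousLinearMap.coe_snd', h]
  ring

end Wedge

section Cylinder

variable {E₀ : Type*} [NormedAddCommGroup E₀] [NormedSpace ℝ E₀]
  {C : Type*} [TopologicalSpace C] [ChartedSpace E₀ C]

/-- An affine change of the coordinate of `ℝ` in `C × ℝ`. -/
def affineCylinder (C : Type*) [TopologicalSpace C] (c d : ℝ) (hc : c ≠ 0) : C × ℝ ≃ₜ C × ℝ where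
  toFun p := (p.1, c * p.2 + d)
  invFun p := (p.1, c⁻¹ * (p.2 - d))
  left_inv p := by ext <;> simp [hc]
  right_inv p := by ext <;> simp [hc]
  continuous_toFun := by fun_prop
  continuous_invFun := by fun_prop

lemma contMDiff_affineCylinder (c d : ℝ) (hc : c ≠ 0) :
    ContMDiff (𝓘(ℝ, E₀).prod 𝓘(ℝ, ℝ)) (𝓘(ℝ, E₀).prod 𝓘(ℝ, ℝ)) ∞ (affineCylinder C c d hc) := by
  have h : ContDiff ℝ ∞ fun t : ℝ ↦ c * t + d := by fun_prop
  exact contMDiff_fst.prodMk (h.contMDiff.comp contMDiff_snd)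

lemma contMDiff_affineCylinder_symm (c d : ℝ) (hc : c ≠ 0) :
    ContMDiff (𝓘(ℝ, E₀).prod 𝓘(ℝ, ℝ)) (𝓘(ℝ, E₀).prod 𝓘(ℝ, ℝ)) ∞
      (affineCylinder C c d hc).symm := by
  have h : ContDiff ℝ ∞ fun t : ℝ ↦ c⁻¹ * (t - d) := by fun_prop
  exact contMDiff_fst.prodMk (h.contMDiff.comp contMDiff_snd)

lemma contMDiff_scale (μ : ℝ) :
    ContMDiff (𝓘(ℝ, E₀).prod 𝓘(ℝ, ℝ)) (𝓘(ℝ, E₀).prod 𝓘(ℝ, ℝ)) ∞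
      fun p : C × ℝ ↦ (p.1, μ * p.2) := by
  have h : ContDiff ℝ ∞ fun t : ℝ ↦ μ * t := by fun_prop
  exact contMDiff_fst.prodMk (h.contMDiff.comp contMDiff_snd)

lemma mfderiv_scale (μ : ℝ) (p : C × ℝ) :
    mfderiv (𝓘(ℝ, E₀).prod 𝓘(ℝ, ℝ)) (𝓘(ℝ, E₀).prod 𝓘(ℝ, ℝ))
      (fun p : C × ℝ ↦ (p.1, μ * p.2)) p =
      (ContinuousLinearMap.id ℝ E₀).prodMap (μ • ContinuousLinearMap.id ℝ ℝ) := by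
  have h : HasFDerivAt (fun t : ℝ ↦ μ * t) (μ • ContinuousLinearMap.id ℝ ℝ) p.2 :=
    (hasFDerivAt_id p.2).const_mul μ
  have h₂ : mfderiv 𝓘(ℝ, ℝ) 𝓘(ℝ, ℝ) (fun t : ℝ ↦ μ * t) p.2 =
      μ • ContinuousLinearMap.id ℝ ℝ := h.hasMFDerivAt.mfderiv
  have h₃ := mfderiv_prodMap (I := 𝓘(ℝ, E₀)) (J := 𝓘(ℝ, E₀)) (p := p) (f := (id : C → C))
    mdifferentiableAt_id h.hasMFDerivAt.mdifferentiableAt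
  rw [mfderiv_id, h₂] at h₃
  exact h₃

/-- The symplectic form of the symplectization is homogeneous. -/
lemma pullback_scale_symplectizationForm (θ : Form 𝓘(ℝ, E₀) C 1) (μ : ℝ) (p : C × ℝ) :
    pullback (𝓘(ℝ, E₀).prod 𝓘(ℝ, ℝ)) (𝓘(ℝ, E₀).prod 𝓘(ℝ, ℝ))
      (fun p : C × ℝ ↦ (p.1, μ * p.2)) (symplectizationForm 𝓘(ℝ, E₀) θ) p =
      μ • symplectizationForm 𝓘(ℝ, E₀) θ p := by
  rw [pullback, mfderiv_scale]
  exact wedge_add_comp_prodMap (F := E₀) (θ p.1) (extD 𝓘(ℝ, E₀) θ p.1) p.2 μ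

end Cylinder

/-! ### The identification of two collars -/

section CollarRel

variable {M : Type u} {N : Type v} {C : Type w} {κ : PartialEquiv M (C × ℝ)}
  {κ' : PartialEquiv N (C × ℝ)}

/-- The identification of the collars of `M` and `N` which multiplies the coordinate of `ℝ` by
`μ`. -/
def collarTransition (κ : PartialEquiv M (C × ℝ)) (κ' : PartialEquiv N (C × ℝ)) (μ : ℝ)
    (x : M) : N :=
  κ'.symm ((κ x).1, μ * (κ x).2)

/-- The points of the collar of `M` which are identified with interior points of `N`. -/
def collarOverlap (κ : PartialEquiv M (C × ℝ)) (S : Set ℝ) (μ : ℝ) : Set M :=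
  κ.source ∩ κ ⁻¹' {p | μ * p.2 ∈ S}

/-- The relation which identifies the collars of `M` and `N`. -/
def CollarRel (κ : PartialEquiv M (C × ℝ)) (κ' : PartialEquiv N (C × ℝ)) (μ : ℝ) (x : M) (y : N) :
    Prop :=
  x ∈ κ.source ∧ y ∈ κ'.source ∧ κ' y = ((κ x).1, μ * (κ x).2)

lemma collarRel_iff {μ : ℝ} (hμ : μ ≠ 0) {x : M} {y : N} :
    CollarRel κ κ' μ⁻¹ x y ↔
      x ∈ κ.source ∧ y ∈ κ'.source ∧ (κ x).1 = (κ' y).1 ∧ (κ x).2 = μ * (κ' y).2 := by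
  rw [CollarRel, Prod.ext_iff, eq_comm (a := (κ' y).1), eq_inv_mul_iff_mul_eq₀ hμ,
    eq_comm (b := (κ x).2)]

/-- Exchanging the two pieces replaces `μ` by its inverse, so every statement about one side serves
for the other. -/
lemma flip_collarRel {μ : ℝ} (hμ : μ ≠ 0) :
    flip (CollarRel κ κ' μ⁻¹) = CollarRel κ' κ μ := by
  funext y x
  rw [flip, eq_iff_iff, collarRel_iff hμ, CollarRel, Prod.ext_iff]
  tauto

lemma isPartialBijection_collarRel {μ : ℝ} (hμ : μ ≠ 0) :
    IsPartialBijection (CollarRel κ κ' μ) where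
  right_unique h h' := κ'.injOn h.2.1 h'.2.1 (h.2.2.trans h'.2.2.symm)
  left_unique h h' := by
    have := h.2.2.symm.trans h'.2.2
    rw [Prod.ext_iff] at this
    exact κ.injOn h.1 h'.1 (Prod.ext this.1 (mul_left_cancel₀ hμ this.2))

end CollarRel

/-! ### Transitions and immersions from border models -/

section Border

variable {E : Type*} [NormedAddCommGroup E] [NormedSpace ℝ E]
  {H : Type*} [TopologicalSpace H] {I : ModelWithCorners ℝ E H}
  {E₀ : Type*} [NormedAddCommGroup E₀] [NormedSpace ℝ E₀]
  {M : Type u} [TopologicalSpace M] [ChartedSpace H M]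
  {N : Type v} [TopologicalSpace N] [ChartedSpace H N]
  {C : Type w} [TopologicalSpace C] [ChartedSpace E₀ C]
  {σ : Form I M 2} {σ' : Form I N 2} {θ : Form 𝓘(ℝ, E₀) C 1}
  {κ : PartialEquiv M (C × ℝ)} {κ' : PartialEquiv N (C × ℝ)} {T T' : Set ℝ} {e e' : ℝ}

lemma IsBorderModel.snd_mem (h : IsBorderModel I 𝓘(ℝ, E₀) σ θ κ T e) {x : M}
    (hx : x ∈ κ.source) : (κ x).2 ∈ T := by
  have := κ.map_source hx
  rw [h.target_eq] at this
  exact this.2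

lemma IsBorderModel.mem_target (h : IsBorderModel I 𝓘(ℝ, E₀) σ θ κ T e) {p : C × ℝ}
    (hp : p.2 ∈ T) : p ∈ κ.target := by
  rw [h.target_eq]
  exact ⟨mem_univ _, hp⟩

lemma IsBorderModel.mem_interior_iff (h : IsBorderModel I 𝓘(ℝ, E₀) σ θ κ T e) {x : M}
    (hx : x ∈ κ.source) : x ∈ I.interior M ↔ (κ x).2 ≠ e := by
  rw [← I.compl_boundary, mem_compl_iff, h.mem_boundary_iff x hx]

/-- The relation is the continuous image of `C × (T ∩ μ⁻¹ T')`, which is compact, although neither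
collar need be. -/
lemma isClosed_collarRel [T2Space M] [T2Space N] [CompactSpace C]
    (h : IsBorderModel I 𝓘(ℝ, E₀) σ θ κ T e) (h' : IsBorderModel I 𝓘(ℝ, E₀) σ' θ κ' T' e') {μ : ℝ}
    (hc : IsCompact (T ∩ (μ * ·) ⁻¹' T')) : IsClosed {p : M × N | CollarRel κ κ' μ p.1 p.2} := by
  have : {p : M × N | CollarRel κ κ' μ p.1 p.2} =
      (fun q : C × ℝ ↦ (κ.symm q, κ'.symm (q.1, μ * q.2))) '' (univ ×ˢ (T ∩ (μ * ·) ⁻¹' T')) := by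
    ext ⟨x, y⟩
    constructor
    · rintro ⟨hx, hy, hxy⟩
      refine ⟨κ x, ⟨mem_univ _, h.snd_mem hx, ?_⟩, ?_⟩
      · have := h'.snd_mem hy
        rwa [hxy] at this
      · change (κ.symm (κ x), κ'.symm ((κ x).1, μ * (κ x).2)) = (x, y)
        rw [κ.left_inv hx, ← show κ' y = _ from hxy, κ'.left_inv hy]
    · rintro ⟨q, ⟨-, hq, hq'⟩, hxy⟩
      obtain ⟨rfl, rfl⟩ := Prod.ext_iff.1 hxy
      have hq₁ : q ∈ κ.target := h.mem_target hq
      have hq₂ : (q.1, μ * q.2) ∈ κ'.target := h'.mem_target hq'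
      refine ⟨κ.map_target hq₁, κ'.map_target hq₂, ?_⟩
      change κ' (κ'.symm (q.1, μ * q.2)) = ((κ (κ.symm q)).1, μ * (κ (κ.symm q)).2)
      rw [κ'.right_inv hq₂, κ.right_inv hq₁]
  rw [this]
  refine ((isCompact_univ.prod hc).image_of_continuousOn (ContinuousOn.prodMk ?_ ?_)).isClosed
  · exact h.contMDiffOn_symm.continuousOn.mono fun q hq ↦ h.mem_target hq.2.1
  · exact h'.contMDiffOn_symm.continuousOn.comp (f := fun q : C × ℝ ↦ (q.1, μ * q.2))
      (by fun_prop) fun q hq ↦ h'.mem_target hq.2.2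

lemma collarTransition_spec {M : Type*} {κ : PartialEquiv M (C × ℝ)}
    (h' : IsBorderModel I 𝓘(ℝ, E₀) σ' θ κ' T' e') {μ : ℝ} {x : M}
    (hx : x ∈ collarOverlap κ (T' \ {e'}) μ) :
    collarTransition κ κ' μ x ∈ κ'.source ∧
      κ' (collarTransition κ κ' μ x) = ((κ x).1, μ * (κ x).2) := by
  have : ((κ x).1, μ * (κ x).2) ∈ κ'.target := h'.mem_target hx.2.1
  exact ⟨κ'.map_target this, κ'.right_inv this⟩

/-- Removing the end `e'` leaves the interior levels of the collar of `N`; `he` says that the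
boundary level of `M` lands among them. -/
lemma isSmoothTransition_collarTransition (h : IsBorderModel I 𝓘(ℝ, E₀) σ θ κ T e)
    (h' : IsBorderModel I 𝓘(ℝ, E₀) σ' θ κ' T' e') {μ : ℝ} (hS : IsOpen (T' \ {e'}))
    (he : μ * e ∈ T' \ {e'}) :
    IsSmoothTransition I (CollarRel κ κ' μ) (collarOverlap κ (T' \ {e'}) μ)
      (collarTransition κ κ' μ) where
  isOpen := h.contMDiffOn.continuousOn.isOpen_inter_preimage h.isOpen_source
    (hS.preimage (by fun_prop))
  boundary_subset x hx := by
    have hxκ := h.boundary_subset hx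
    refine ⟨hxκ, ?_⟩
    rwa [mem_preimage, mem_ofPred_eq, (h.mem_boundary_iff x hxκ).1 hx]
  contMDiffOn := h'.contMDiffOn_symm.comp ((contMDiff_scale μ).comp_contMDiffOn
    (h.contMDiffOn.mono inter_subset_left)) fun x hx ↦ h'.mem_target hx.2.1
  rel x hx := ⟨hx.1, collarTransition_spec h' hx⟩
  mapsTo x hx := by
    obtain ⟨h₁, h₂⟩ := collarTransition_spec h' hx
    rw [h'.mem_interior_iff h₁, h₂]
    exact hx.2.2
  mem_of_rel := by
    rintro x y ⟨hx, hy, hxy⟩ hyI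
    have h₁ := h'.snd_mem hy
    have h₂ := (h'.mem_interior_iff hy).1 hyI
    rw [hxy] at h₁ h₂
    exact ⟨hx, h₁, h₂⟩

/-- In collar coordinates the transition is the scaling by `μ`. Since both forms are modelled on the
same `Ω`, homogeneity gives the factor. -/
lemma pullback_collarTransition (h : IsBorderModel I 𝓘(ℝ, E₀) σ θ κ T e)
    (h' : IsBorderModel I 𝓘(ℝ, E₀) σ' θ κ' T' e') {μ : ℝ} (hS : IsOpen (T' \ {e'}))
    (he : μ * e ∈ T' \ {e'}) {x : M} (hx : x ∈ collarOverlap κ (T' \ {e'}) μ) :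
    pullback I I (collarTransition κ κ' μ) σ' x = μ • σ x := by
  have ht := isSmoothTransition_collarTransition h h' hS he
  have hW := ht.isOpen.mem_nhds hx
  have hg : MDifferentiableAt I I (collarTransition κ κ' μ) x :=
    (ht.contMDiffOn.contMDiffAt hW).mdifferentiableAt (by simp)
  obtain ⟨h₁, -⟩ := collarTransition_spec h' hx
  have hκ' : MDifferentiableAt I (𝓘(ℝ, E₀).prod 𝓘(ℝ, ℝ)) κ' (collarTransition κ κ' μ x) :=
    (h'.contMDiffOn.contMDiffAt (h'.isOpen_source.mem_nhds h₁)).mdifferentiableAt (by simp)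
  have hκ : MDifferentiableAt I (𝓘(ℝ, E₀).prod 𝓘(ℝ, ℝ)) κ x :=
    (h.contMDiffOn.contMDiffAt (h.isOpen_source.mem_nhds hx.1)).mdifferentiableAt (by simp)
  have hs : MDifferentiableAt (𝓘(ℝ, E₀).prod 𝓘(ℝ, ℝ)) (𝓘(ℝ, E₀).prod 𝓘(ℝ, ℝ))
      (fun p : C × ℝ ↦ (p.1, μ * p.2)) (κ x) := (contMDiff_scale μ).mdifferentiableAt (by simp)
  have hev : κ' ∘ collarTransition κ κ' μ =ᶠ[𝓝 x] (fun p : C × ℝ ↦ (p.1, μ * p.2)) ∘ κ := by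
    filter_upwards [hW] with y hy
    exact (collarTransition_spec h' hy).2
  refine (pullback_congr_form (h'.symplectic _ h₁).symm).trans ?_
  refine (pullback_comp _ hκ' hg).symm.trans ((pullback_congr _ hev).trans ?_)
  refine (pullback_comp _ hs hκ).trans ?_
  refine (pullback_congr_form (τ := μ • symplectizationForm 𝓘(ℝ, E₀) θ)
    (pullback_scale_symplectizationForm θ μ (κ x))).trans ?_
  rw [pullback_smul]
  exact congrArg (μ • ·) (h.symplectic x hx.1)

/-- The identification of the interior part of a collar with a cylinder. -/
def borderInterior (h : IsBorderModel I 𝓘(ℝ, E₀) σ θ κ T e) (hS : IsOpen (T \ {e})) :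
    OpenPartialHomeomorph M (C × ℝ) where
  toFun := κ
  invFun := κ.symm
  source := κ.source ∩ κ ⁻¹' (univ ×ˢ (T \ {e}))
  target := univ ×ˢ (T \ {e})
  map_source' x hx := hx.2
  map_target' p hp := by
    have hp' := h.mem_target hp.2.1
    refine ⟨κ.map_target hp', ?_⟩
    rwa [mem_preimage, κ.right_inv hp']
  left_inv' x hx := κ.left_inv hx.1
  right_inv' p hp := κ.right_inv (h.mem_target hp.2.1)
  open_source := h.contMDiffOn.continuousOn.isOpen_inter_preimage h.isOpen_source
    (isOpen_univ.prod hS)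
  open_target := isOpen_univ.prod hS
  continuousOn_toFun := h.contMDiffOn.continuousOn.mono inter_subset_left
  continuousOn_invFun := h.contMDiffOn_symm.continuousOn.mono fun p hp ↦ h.mem_target hp.2.1

/-- The affine change normalizes convex and concave collars alike, so that the coordinate is
nonnegative as in a half-space. -/
lemma isCollar_transEquiv (h : IsBorderModel I 𝓘(ℝ, E₀) σ θ κ T e) {c d : ℝ} (hc : c ≠ 0)
    {S : Set ℝ} (hS : IsOpen S) (hT : ∀ t, t ∈ T ↔ c * t + d ∈ S ∩ Ici 0) :
    IsCollar (E₀ := E₀) I (κ.transEquiv (affineCylinder C c d hc).toEquiv) S where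
  isOpen := hS
  isOpen_source := h.isOpen_source
  target_eq := by
    ext p
    have : p ∈ (κ.transEquiv (affineCylinder C c d hc).toEquiv).target ↔
      (affineCylinder C c d hc).symm p ∈ κ.target := Iff.rfl
    rw [this, h.target_eq, mem_prod, mem_prod, hT]
    have h₂ : c * ((affineCylinder C c d hc).symm p).2 + d = p.2 :=
      congrArg Prod.snd ((affineCylinder C c d hc).apply_symm_apply p)
    rw [h₂]
    simp
  contMDiffOn := (contMDiff_affineCylinder c d hc).comp_contMDiffOn h.contMDiffOn
  contMDiffOn_symm := h.contMDiffOn_symm.comp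
    (contMDiff_affineCylinder_symm c d hc).contMDiffOn fun _ hp ↦ hp

/-- The inclusion of `M` in the glued manifold is an immersion: at interior points by construction,
at boundary points by means of the collar of the other piece. -/
lemma isImmersionOfComplement_of_border {X : Type*} [TopologicalSpace X] [ChartedSpace E X]
    [IsManifold 𝓘(ℝ, E) ∞ X] [IsManifold I ∞ M] [IsManifold I ∞ N] [IsManifold 𝓘(ℝ, E₀) ∞ C]
    (h : IsBorderModel I 𝓘(ℝ, E₀) σ θ κ T e) (h' : IsBorderModel I 𝓘(ℝ, E₀) σ' θ κ' T' e') {μ : ℝ}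
    (hμ : μ ≠ 0) (hS : IsOpen (T' \ {e'})) (he : μ * e ∈ T' \ {e'}) {c d : ℝ} (hc : c ≠ 0)
    {S : Set ℝ} (hSo : IsOpen S) (hT : ∀ t, t ∈ T ↔ c * t + d ∈ S ∩ Ici 0)
    (L : (E₀ × ℝ) ≃L[ℝ] E) (hL : ∀ p, L p ∈ range I ↔ 0 ≤ p.2)
    {Φ : OpenPartialHomeomorph M X} {Ψ : OpenPartialHomeomorph N X}
    (hΦ : Φ.source = I.interior M) (hΨ : Ψ.source = I.interior N)
    (hΦX : ∀ s, pushChart I Φ s ∈ IsManifold.maximalAtlas 𝓘(ℝ, E) ∞ X)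
    (hΨX : ∀ s, pushChart I Ψ s ∈ IsManifold.maximalAtlas 𝓘(ℝ, E) ∞ X)
    (hcont : Continuous Φ)
    (hΦΨ : ∀ x ∈ collarOverlap κ (T' \ {e'}) μ, Φ x = Ψ (collarTransition κ κ' μ x)) :
    Manifold.IsImmersionOfComplement PUnit.{1} I 𝓘(ℝ, E) ∞ Φ := by
  intro x
  by_cases hxI : x ∈ I.interior M
  · exact isImmersionAt_of_pushChart_mem hΦ.subset hΦX (hΦ ▸ hxI)
  rw [← mem_compl_iff, I.compl_interior] at hxI
  have ht := isSmoothTransition_collarTransition h h' hS he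
  have hxW := ht.boundary_subset hxI
  -- The level `t` in `M` becomes `μ * t` in `N`. The slope `c / μ` there makes the normalized
  -- coordinates agree: `(c / μ) * (μ * t) + d = c * t + d`.
  have hc' : c / μ ≠ 0 := div_ne_zero hc hμ
  let J := (borderInterior h' hS).transHomeomorph (affineCylinder C (c / μ) d hc')
  have hJ : ContMDiffOn I (𝓘(ℝ, E₀).prod 𝓘(ℝ, ℝ)) ∞ J J.source :=
    (contMDiff_affineCylinder (c / μ) d hc').comp_contMDiffOn
      (h'.contMDiffOn.mono inter_subset_left)
  have hJ' : ContMDiffOn (𝓘(ℝ, E₀).prod 𝓘(ℝ, ℝ)) I ∞ J.symm J.target :=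
    (h'.contMDiffOn_symm.mono fun p hp ↦ h'.mem_target hp.2.1).comp
      (contMDiff_affineCylinder_symm (c / μ) d hc').contMDiffOn fun _ hp ↦ hp
  have hΨsymm : ∀ y ∈ collarOverlap κ (T' \ {e'}) μ, Ψ.symm (Φ y) = collarTransition κ κ' μ y :=
    fun y hy ↦ by rw [hΦΨ y hy, Ψ.left_inv (hΨ ▸ ht.mapsTo hy)]
  refine isImmersionAt_of_collar (isCollar_transEquiv h hc hSo hT) (K := Ψ.symm.trans J)
    ?_ ?_ L hL hcont.continuousAt hxW.1 ?_ ht.isOpen hxW fun y hy ↦ ?_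
  · exact hJ.comp ((contMDiffOn_symm_of_pushChart_mem hΨ.subset hΨX).mono
      fun z hz ↦ hz.1) fun z hz ↦ hz.2
  · exact (contMDiffOn_of_pushChart_mem hΨ.subset hΨX).comp (hJ'.mono fun p hp ↦ hp.1)
      fun p hp ↦ hp.2
  · refine ⟨?_, ?_⟩
    · rw [hΦΨ x hxW]
      exact Ψ.map_source (hΨ ▸ ht.mapsTo hxW)
    · change Ψ.symm (Φ x) ∈ J.source
      rw [hΨsymm x hxW]
      obtain ⟨h₁, h₂⟩ := collarTransition_spec h' hxW
      refine ⟨h₁, ?_⟩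
      rw [mem_preimage, h₂]
      exact ⟨mem_univ _, hxW.2⟩
  · change affineCylinder C (c / μ) d hc' (κ' (Ψ.symm (Φ y))) = affineCylinder C c d hc (κ y)
    rw [hΨsymm y hy, (collarTransition_spec h' hy).2]
    refine Prod.ext rfl ?_
    change c / μ * (μ * (κ y).2) + d = c * (κ y).2 + d
    rw [← mul_assoc, div_mul_cancel₀ c hμ]

end Border

/-! ### Assembling the glued symplectic manifold -/

section Main

variable {E : Type*} [NormedAddCommGroup E] [NormedSpace ℝ E]
  {H : Type*} [TopologicalSpace H] {I : ModelWithCorners ℝ E H}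
  {E₀ : Type*} [NormedAddCommGroup E₀] [NormedSpace ℝ E₀]
  {M : Type u} [TopologicalSpace M] [ChartedSpace H M]
  {N : Type v} [TopologicalSpace N] [ChartedSpace H N]
  {C : Type w} [TopologicalSpace C] [ChartedSpace E₀ C]
  {σ₁ : Form I M 2} {σ₂ : Form I N 2} {θ : Form 𝓘(ℝ, E₀) C 1}
  {κ₁ : PartialEquiv M (C × ℝ)} {κ₂ : PartialEquiv N (C × ℝ)} {T₁ T₂ : Set ℝ} {e₁ e₂ : ℝ}

/-- Two symplectic manifolds with borders modelled on the same contact manifold can be glued along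
their collars, when the collars, rescaled by `lam`, overlap in a compact piece of the cylinder. -/
theorem exists_symplectic_glue [IsManifold I ∞ M] [IsManifold I ∞ N] [IsManifold 𝓘(ℝ, E₀) ∞ C]
    [T2Space M] [T2Space N] [CompactSpace M] [CompactSpace N] [CompactSpace C] [Nonempty C]
    (hσ₁ : IsSymplectic I σ₁) (hσ₂ : IsSymplectic I σ₂)
    (h₁ : IsBorderModel I 𝓘(ℝ, E₀) σ₁ θ κ₁ T₁ e₁) (h₂ : IsBorderModel I 𝓘(ℝ, E₀) σ₂ θ κ₂ T₂ e₂)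
    {lam : ℝ} (hlam : lam ≠ 0) (hS₁ : IsOpen (T₁ \ {e₁})) (hS₂ : IsOpen (T₂ \ {e₂}))
    (he₁ : lam⁻¹ * e₁ ∈ T₂ \ {e₂}) (he₂ : lam * e₂ ∈ T₁ \ {e₁})
    (hcomp : IsCompact (T₁ ∩ (lam⁻¹ * ·) ⁻¹' T₂))
    {c₁ d₁ : ℝ} (hc₁ : c₁ ≠ 0) {S₁ : Set ℝ} (hSo₁ : IsOpen S₁)
    (hT₁ : ∀ t, t ∈ T₁ ↔ c₁ * t + d₁ ∈ S₁ ∩ Ici 0)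
    {c₂ d₂ : ℝ} (hc₂ : c₂ ≠ 0) {S₂ : Set ℝ} (hSo₂ : IsOpen S₂)
    (hT₂ : ∀ t, t ∈ T₂ ↔ c₂ * t + d₂ ∈ S₂ ∩ Ici 0)
    (L : (E₀ × ℝ) ≃L[ℝ] E) (hL : ∀ p, L p ∈ range I ↔ 0 ≤ p.2) :
    ∃ (X : Type (max u v)) (_ : TopologicalSpace X) (_ : ChartedSpace E X)
      (_ : IsManifold 𝓘(ℝ, E) ∞ X) (_ : T2Space X) (_ : CompactSpace X)
      (σ : Form 𝓘(ℝ, E) X 2) (φ₁ : M → X) (φ₂ : N → X),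
      IsSymplectic 𝓘(ℝ, E) σ ∧
      Manifold.IsSmoothEmbedding I 𝓘(ℝ, E) ∞ φ₁ ∧
      Manifold.IsSmoothEmbedding I 𝓘(ℝ, E) ∞ φ₂ ∧
      pullback I 𝓘(ℝ, E) φ₁ σ = σ₁ ∧
      pullback I 𝓘(ℝ, E) φ₂ σ = lam • σ₂ ∧
      φ₁ '' I.interior M ∪ φ₂ '' I.interior N = univ ∧
      ∀ (x : M) (y : N), φ₁ x = φ₂ y ↔
        x ∈ κ₁.source ∧ y ∈ κ₂.source ∧ (κ₁ x).1 = (κ₂ y).1 ∧ (κ₁ x).2 = lam * (κ₂ y).2 := by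
  have hr : IsPartialBijection (CollarRel κ₁ κ₂ lam⁻¹) :=
    isPartialBijection_collarRel (inv_ne_zero hlam)
  have hcl := isClosed_collarRel h₁ h₂ hcomp
  have ht₁ := isSmoothTransition_collarTransition h₁ h₂ hS₂ he₁
  have ht₂ := isSmoothTransition_collarTransition h₂ h₁ hS₁ he₂
  have ht₂' : IsSmoothTransition I (flip (CollarRel κ₁ κ₂ lam⁻¹))
      (collarOverlap κ₂ (T₁ \ {e₁}) lam) (collarTransition κ₂ κ₁ lam) := by
    rwa [flip_collarRel hlam]
  -- The inverse of a `PartialEquiv` is a total function, so level `0` may lie outside the collar;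
  -- only the existence of some point matters.
  have : Nonempty M := ⟨κ₁.symm (Classical.arbitrary C, 0)⟩
  have : Nonempty N := ⟨κ₂.symm (Classical.arbitrary C, 0)⟩
  obtain ⟨cs, hman, Φ, Ψ, hΦs, hΨs, hΦc, hΨc, hΦX, hΨX, hX⟩ :=
    exists_chartedSpace_glue hr ht₁ ht₂'
  have hT2 : T2Space (Glue hr) := Glue.t2Space hr hcl
  have hcΦ : Continuous Φ := hΦc ▸ Glue.continuous_inl hr
  have hcΨ : Continuous Ψ := hΨc ▸ Glue.continuous_inr hr
  have hΦΨ : ∀ x ∈ collarOverlap κ₁ (T₂ \ {e₂}) lam⁻¹,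
      Φ x = Ψ (collarTransition κ₁ κ₂ lam⁻¹ x) := by
    rw [hΦc, hΨc]
    exact fun x hx ↦ Glue.inl_eq_inr_of_mem hr ht₁ hx
  have hΨΦ : ∀ y ∈ collarOverlap κ₂ (T₁ \ {e₁}) lam, Ψ y = Φ (collarTransition κ₂ κ₁ lam y) := by
    rw [hΦc, hΨc]
    exact fun y hy ↦ Glue.inr_eq_inl_of_mem hr ht₂' hy
  have hd₁ : ∀ x ∈ collarOverlap κ₁ (T₂ \ {e₂}) lam⁻¹,
      MDifferentiableAt I I (collarTransition κ₁ κ₂ lam⁻¹) x := fun x hx ↦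
    (ht₁.contMDiffOn.contMDiffAt (ht₁.isOpen.mem_nhds hx)).mdifferentiableAt (by simp)
  have hd₂ : ∀ y ∈ collarOverlap κ₂ (T₁ \ {e₁}) lam,
      MDifferentiableAt I I (collarTransition κ₂ κ₁ lam) y := fun y hy ↦
    (ht₂.contMDiffOn.contMDiffAt (ht₂.isOpen.mem_nhds hy)).mdifferentiableAt (by simp)
  have hp₁ : ∀ x ∈ collarOverlap κ₁ (T₂ \ {e₂}) lam⁻¹,
      pullback I I (collarTransition κ₁ κ₂ lam⁻¹) (lam • σ₂) x = σ₁ x := by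
    intro x hx
    rw [pullback_smul]
    -- The transition multiplies `σ₂` by `lam⁻¹`, which cancels the rescaling by `lam`.
    refine (congrArg (lam • ·) (pullback_collarTransition h₁ h₂ hS₂ he₁ hx)).trans ?_
    exact smul_inv_smul₀ hlam _
  have hp₂ : ∀ y ∈ collarOverlap κ₂ (T₁ \ {e₁}) lam,
      pullback I I (collarTransition κ₂ κ₁ lam) σ₁ y = (lam • σ₂) y :=
    fun y hy ↦ pullback_collarTransition h₂ h₁ hS₁ he₂ hy
  have hmem : ∀ z ∈ Φ.target, z ∈ Ψ.target → Φ.symm z ∈ collarOverlap κ₁ (T₂ \ {e₂}) lam⁻¹ := by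
    intro z hz hz'
    refine ht₁.mem_of_rel (y := Ψ.symm z) ?_ (hΨs ▸ Ψ.map_target hz')
    rw [← Glue.inl_eq_inr hr, ← hΦc, ← hΨc, Φ.right_inv hz, Ψ.right_inv hz']
  obtain ⟨σ, hσ, hσΦ, hσΨ⟩ := exists_isSymplectic_glue hΦs.subset hΨs.subset hΦX hΨX hX hσ₁
    (hσ₂.smul hlam) (by
      intro z hz hz'
      have hev : ⇑Ψ.symm =ᶠ[𝓝 z] collarTransition κ₁ κ₂ lam⁻¹ ∘ Φ.symm := by
        filter_upwards [Φ.open_target.mem_nhds hz, Ψ.open_target.mem_nhds hz'] with w hw hw'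
        have hwo := hmem w hw hw'
        rw [← Φ.right_inv hw, hΦΨ _ hwo, Ψ.left_inv (hΨs ▸ ht₁.mapsTo hwo), ← hΦΨ _ hwo,
          Function.comp_apply, Φ.left_inv (Φ.map_target hw)]
      refine Eq.symm ((pullback_congr _ hev).trans ?_)
      refine (pullback_comp _ (hd₁ _ (hmem z hz hz'))
        (mdifferentiableAt_symm_of_pushChart_mem hΦs.subset hΦX hz)).trans ?_
      exact pullback_congr_form (hp₁ _ (hmem z hz hz')))
  refine ⟨Glue hr, inferInstance, cs, hman, hT2, inferInstance, σ, Φ, Ψ, hσ, ⟨?_, ?_⟩, ⟨?_, ?_⟩,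
    ?_, ?_, ?_, ?_⟩
  · exact (isImmersionOfComplement_of_border h₁ h₂ (inv_ne_zero hlam) hS₂ he₁ hc₁ hSo₁ hT₁ L hL
      hΦs hΨs hΦX hΨX hcΦ hΦΨ).isImmersion
  · exact (hcΦ.isClosedEmbedding (hΦc ▸ Glue.inl_injective hr)).isEmbedding
  · exact (isImmersionOfComplement_of_border h₂ h₁ hlam hS₁ he₂ hc₂ hSo₂ hT₂ L hL
      hΨs hΦs hΨX hΦX hcΨ hΨΦ).isImmersion
  · exact (hcΨ.isClosedEmbedding (hΨc ▸ Glue.inr_injective hr)).isEmbedding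
  · funext x
    by_cases hx : x ∈ I.interior M
    · exact (pullback_eq_pullback_of_eventuallyEq hΦs.subset hΦX hσΦ (g := id) .rfl
        mdifferentiableAt_id (hΦs ▸ hx)).trans (pullback_eq_self σ₁ .rfl)
    -- `Φ` parametrizes an open set only over the interior, so at a boundary point the inclusion is
    -- read through `Ψ` as `Ψ` composed with the transition.
    · rw [← mem_compl_iff, I.compl_interior] at hx
      have hxW := ht₁.boundary_subset hx
      refine (pullback_eq_pullback_of_eventuallyEq hΨs.subset hΨX hσΨ ?_ (hd₁ x hxW)
        (hΨs ▸ ht₁.mapsTo hxW)).trans (hp₁ x hxW)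
      exact Filter.eventually_of_mem (ht₁.isOpen.mem_nhds hxW) hΦΨ
  · funext y
    by_cases hy : y ∈ I.interior N
    · exact (pullback_eq_pullback_of_eventuallyEq hΨs.subset hΨX hσΨ (g := id) .rfl
        mdifferentiableAt_id (hΨs ▸ hy)).trans (pullback_eq_self (lam • σ₂) .rfl)
    · rw [← mem_compl_iff, I.compl_interior] at hy
      have hyW := ht₂.boundary_subset hy
      refine (pullback_eq_pullback_of_eventuallyEq hΦs.subset hΦX hσΦ ?_ (hd₂ y hyW)
        (hΦs ▸ ht₂.mapsTo hyW)).trans (hp₂ y hyW)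
      exact Filter.eventually_of_mem (ht₂.isOpen.mem_nhds hyW) hΨΦ
  · rw [← hΦs, ← hΨs, Φ.image_source_eq_target, Ψ.image_source_eq_target, eq_univ_iff_forall]
    exact fun z ↦ (hX z).imp And.left And.left
  · intro x y
    rw [hΦc, hΨc, Glue.inl_eq_inr, collarRel_iff hlam]

end Main

/-! ### The Euclidean half-space as a product -/

section HalfSpace

/-- The splitting of Euclidean space as the product of the last coordinates and the first one. -/
def euclideanSplitting (m : ℕ) :
    (EuclideanSpace ℝ (Fin m) × ℝ) ≃L[ℝ] EuclideanSpace ℝ (Fin (m + 1)) :=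
  LinearEquiv.toContinuousLinearEquiv
    { toFun := fun p ↦ WithLp.toLp 2 (Fin.cons p.2 p.1)
      invFun := fun y ↦ (WithLp.toLp 2 (Fin.tail y), y 0)
      map_add' := fun p q ↦ by
        ext i
        refine Fin.cases ?_ (fun j ↦ ?_) i <;> simp
      map_smul' := fun c p ↦ by
        ext i
        refine Fin.cases ?_ (fun j ↦ ?_) i <;> simp
      left_inv := fun p ↦ rfl
      right_inv := fun y ↦ by
        ext i
        refine Fin.cases ?_ (fun j ↦ ?_) i <;> simp [Fin.tail] }

lemma euclideanSplitting_mem_range_iff (m : ℕ) (p : EuclideanSpace ℝ (Fin m) × ℝ) :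
    euclideanSplitting m p ∈ range (𝓡∂ (m + 1)) ↔ 0 ≤ p.2 := by
  rw [range_modelWithCornersEuclideanHalfSpace]
  rfl

end HalfSpace

end SymCon

end

theorem mainTheorem8 (n : ℕ)
    (C : Type w) [TopologicalSpace C] [ChartedSpace (EuclideanSpace ℝ (Fin (2 * n + 1))) C]
    [IsManifold (𝓡 (2 * n + 1)) ∞ C] [T2Space C] [CompactSpace C] [ConnectedSpace C]
    (θ : SymCon.Form (𝓡 (2 * n + 1)) C 1) (hθ : SymCon.IsContactForm (𝓡 (2 * n + 1)) θ)
    (M₁ : Type u) [TopologicalSpace M₁] [ChartedSpace (EuclideanHalfSpace (2 * n + 2)) M₁]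
    [IsManifold (𝓡∂ (2 * n + 2)) ∞ M₁] [T2Space M₁] [CompactSpace M₁]
    (σ₁ : SymCon.Form (𝓡∂ (2 * n + 2)) M₁ 2) (hσ₁ : SymCon.IsSymplectic (𝓡∂ (2 * n + 2)) σ₁)
    (κ₁ : PartialEquiv M₁ (C × ℝ))
    (hκ₁ : SymCon.IsConvexBorder (𝓡∂ (2 * n + 2)) (𝓡 (2 * n + 1)) σ₁ θ κ₁)
    (M₂ : Type v) [TopologicalSpace M₂] [ChartedSpace (EuclideanHalfSpace (2 * n + 2)) M₂]
    [IsManifold (𝓡∂ (2 * n + 2)) ∞ M₂] [T2Space M₂] [CompactSpace M₂]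
    (σ₂ : SymCon.Form (𝓡∂ (2 * n + 2)) M₂ 2) (hσ₂ : SymCon.IsSymplectic (𝓡∂ (2 * n + 2)) σ₂)
    (κ₂ : PartialEquiv M₂ (C × ℝ))
    (hκ₂ : SymCon.IsConcaveBorder (𝓡∂ (2 * n + 2)) (𝓡 (2 * n + 1)) σ₂ θ κ₂) :
    ∃ lam : ℝ, 0 < lam ∧
    ∃ (X : Type (max u v)) (_ : TopologicalSpace X)
      (_ : ChartedSpace (EuclideanSpace ℝ (Fin (2 * n + 2))) X)
      (_ : IsManifold (𝓡 (2 * n + 2)) ∞ X) (_ : T2Space X) (_ : CompactSpace X)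
      (σ : SymCon.Form (𝓡 (2 * n + 2)) X 2) (φ₁ : M₁ → X) (φ₂ : M₂ → X),
      SymCon.IsSymplectic (𝓡 (2 * n + 2)) σ ∧
      Manifold.IsSmoothEmbedding (𝓡∂ (2 * n + 2)) (𝓡 (2 * n + 2)) ∞ φ₁ ∧
      Manifold.IsSmoothEmbedding (𝓡∂ (2 * n + 2)) (𝓡 (2 * n + 2)) ∞ φ₂ ∧
      SymCon.pullback (𝓡∂ (2 * n + 2)) (𝓡 (2 * n + 2)) φ₁ σ = σ₁ ∧
      SymCon.pullback (𝓡∂ (2 * n + 2)) (𝓡 (2 * n + 2)) φ₂ σ = lam • σ₂ ∧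
      -- the interiors of the two pieces already cover the glued manifold
      φ₁ '' (𝓡∂ (2 * n + 2)).interior M₁ ∪ φ₂ '' (𝓡∂ (2 * n + 2)).interior M₂ = Set.univ ∧
      -- the two pieces are glued along their collars, by means of the standard models
      ∀ (x : M₁) (y : M₂), φ₁ x = φ₂ y ↔
        x ∈ κ₁.source ∧ y ∈ κ₂.source ∧ (κ₁ x).1 = (κ₂ y).1 ∧ (κ₁ x).2 = lam * (κ₂ y).2 := by
  obtain ⟨a₁, b₁, ha₁, hab₁, h₁⟩ := hκ₁
  obtain ⟨a₂, b₂, ha₂, hab₂, h₂⟩ := hκ₂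
  have hb₁ : 0 < b₁ := ha₁.trans hab₁
  have hb₂ : 0 < b₂ := ha₂.trans hab₂
  -- The bounds on `lam` encode `a₁ < lam * a₂`, `b₁ < lam * b₂` and `lam * a₂ < b₁`: each rescaled
  -- end lies strictly inside the other collar.
  have hlt : max (a₁ / a₂) (b₁ / b₂) < b₁ / a₂ :=
    max_lt (div_lt_div_of_pos_right hab₁ ha₂) (div_lt_div_of_pos_left hb₁ ha₂ hab₂)
  obtain ⟨lam, hlam, hlam'⟩ := exists_between hlt
  obtain ⟨hl₁, hl₂⟩ := max_lt_iff.1 hlam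
  have hpos : 0 < lam := (div_pos ha₁ ha₂).trans hl₁
  rw [div_lt_iff₀ ha₂] at hl₁
  rw [div_lt_iff₀ hb₂] at hl₂
  rw [lt_div_iff₀ ha₂] at hlam'
  have hinv : ∀ t : ℝ, lam * (lam⁻¹ * t) = t := fun t ↦ mul_inv_cancel_left₀ hpos.ne' t
  have hmul : ∀ {s t : ℝ}, s < lam⁻¹ * t ↔ lam * s < t := fun {s t} ↦ by
    rw [← mul_lt_mul_iff_right₀ hpos, hinv]
  have hmul' : ∀ {s t : ℝ}, lam⁻¹ * t < s ↔ t < lam * s := fun {s t} ↦ by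
    rw [← mul_lt_mul_iff_right₀ hpos, hinv]
  -- The open end of each collar lies beyond the closed end of the other, so the two half-open
  -- intervals meet in a closed one.
  have hcomp : Ioc a₁ b₁ ∩ (lam⁻¹ * ·) ⁻¹' Ico a₂ b₂ = Icc (lam * a₂) b₁ := by
    ext t
    simp only [mem_inter_iff, mem_Ioc, mem_preimage, mem_Ico, mem_Icc, hmul', ← not_lt (b := a₂)]
    constructor
    · rintro ⟨⟨-, h⟩, h', -⟩
      exact ⟨not_lt.1 h', h⟩
    · rintro ⟨h, h'⟩
      exact ⟨⟨hl₁.trans_le h, h'⟩, not_lt.2 h, h'.trans_lt hl₂⟩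
  -- The normalized collar coordinates are the distances to the boundary level: `b₁ - t` on the
  -- convex side and `t - a₂` on the concave side.
  refine ⟨lam, hpos, SymCon.exists_symplectic_glue hσ₁ hσ₂ h₁ h₂ hpos.ne' ?_ ?_ ?_ ?_
    (hcomp ▸ isCompact_Icc) (c₁ := -1) (d₁ := b₁) (S₁ := Iio (b₁ - a₁)) (by simp) isOpen_Iio ?_
    (c₂ := 1) (d₂ := -a₂) (S₂ := Iio (b₂ - a₂)) one_ne_zero isOpen_Iio ?_
    (SymCon.euclideanSplitting (2 * n + 1))
    (SymCon.euclideanSplitting_mem_range_iff (2 * n + 1))⟩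
  · rw [Ioc_sdiff_right]
    exact isOpen_Ioo
  · rw [Ico_sdiff_left]
    exact isOpen_Ioo
  · rw [Ico_sdiff_left]
    exact ⟨hmul.2 hlam', hmul'.2 hl₂⟩
  · rw [Ioc_sdiff_right]
    exact ⟨hl₁, hlam'⟩
  · intro t
    simp only [mem_Ioc, mem_inter_iff, mem_Iio, mem_Ici]
    constructor <;> rintro ⟨h, h'⟩ <;> constructor <;> linarith
  · intro t
    simp only [mem_Ico, mem_inter_iff, mem_Iio, mem_Ici]
    constructor <;> rintro ⟨h, h'⟩ <;> constructor <;> linarith
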